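/- Let $A\in\mathbb{R}^{m\times n}$ have full column rank $n\ge 1$ (so $m\ge n$), with rows $a_1^\top,\dots,a_m^\top$, let $p\ge 4$ and $0<\varepsilon\le 1$, and put $\alpha=\frac{2}{p-2}$. Write $W=\mathrm{Diag}(w)$ for a vector $w\in\mathbb{R}^m$, and let $$\sigma_i(w)=w_i\,a_i^\top(A^\top WA)^{-1}a_i,\qquad \rho_i(w)=\sigma_i(w)/w_i^{1+\alpha}.$$ For $a,b\in\mathbb{R}$, $a\approx_\varepsilon b$ means $(1-\varepsilon)a\le b\le(1+\varepsilon)a$. The $\ell_p$ Lewis weights of $A$ are the entries of the vector $v\in\mathbb{R}^m_{\ge0}$ with $A^\top V^{1-2/p}A$ invertible and $v_i^{2/p}=a_i^\top(A^\top V^{1-2/p}A)^{-1}a_i$ for all $i$. **Algorithm.** $\mathrm{RoundSequential}(w)$ makes one pass over $i=1,\dots,m$; for each $i$ such that $\rho_i(w)\ge1$ at the current vector $w$, it replaces $w_i$ by $w_i(1+\delta_i)$, where $\delta_i>-1$ solves $\rho_i(w)=(1+\delta_i\sigma_i(w))(1+\delta_i)^\alpha$ (exact coordinate minimization of the objective $\mathcal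 F$ below). $\mathrm{Descent}(w)$ replaces simultaneously every $w_i$ by $w_i\bigl[1+\frac{1}{3\max(\alpha,1)}\cdot\frac{\rho_i(w)-1}{\rho_i(w)+1}\bigr]$. The algorithm starts at $w_i=n/m$ for all $i$, repeats $w\leftarrow\mathrm{Descent}(\mathrm{RoundSequential}(w))$ exactly $\mathcal T=\lceil c\max(\alpha^{-1},\alpha)\log(m/\widetilde\varepsilon)\rceil$ times, where $\widetilde\varepsilon=\frac{\alpha^8\varepsilon^4}{(25m(\sqrt n+\alpha)(\alpha+\alpha^{-1}))^4}$, sets $w_{\mathrm R}=\mathrm{RoundSequential}(w)$, and returns $\widehat w_i=(a_i^\top(A^\top W_{\mathrm R}A)^{-1}a_i)^{1/\alpha}$. **Theorem.** For a suitable choice of the absolute constant $c\in\mathbb{N}$ there is an absolute constant $C$ such that, for all such $A,p,\varepsilon$: 1. The vector $v$ of Lewis weights exists and is unique, and the output $\widehat w$ is $\varepsilon$-approximate: with $\overline w=v^{1-2/p}$ (entrywise), $\widehat w_i\approx_\varepsilon\overline w_i$ and $\widehat w_i^{\,p/(p-2)}\approx_\varepsilon v_i$ for all $i$. If $A$ has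 no zero row, then $\widehat w$ and $v$ have positive entries and $\overline w$ is the unique minimizer over $w\in\mathbb{R}^m_{>0}$ of $\mathcal F(w)=-\log\det(A^\top WA)+\frac1{1+\alpha}\sum_iw_i^{1+\alpha}$. 2. The algorithm, implemented as follows, uses at most $C\,p\,m\log(mp/\varepsilon)$ iterations (leverage score computations, of the rounding passes, of the descent steps and of the output together), each of which computes the leverage score of one row of $DA$ for a positive diagonal matrix $D=W^{1/2}$, where $w$ is the current vector. 3. Its total runtime is at most $C\,p\,m\,n^2\log(mp/\varepsilon)$ steps of a unit-cost real random access machine whose instructions are integer constants, $+,-,\times,/,\max,\sqrt{\cdot},\log$, real powers, comparison, rounding up to an integer, the solution of the scalar equation for $\delta_i$, and loop control. The implementation keeps $(A^\top WA)^{-1}$ in memory and updates it by the Sherman–Morrison formula whenever an entry of $w$ changes; it returns exactly $\widehat w$. -/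

import Mathlib

open Matrix

noncomputable section

namespace Lewis

/-! ## Lewis weights and the convex program -/

/-- `Aᵀ W A`, where `W` is the diagonal matrix with the vector `w` on its diagonal. -/
def gram {m n : ℕ} (A : Matrix (Fin m) (Fin n) ℝ) (w : Fin m → ℝ) : Matrix (Fin n) (Fin n) ℝ :=
  Aᵀ * Matrix.diagonal w * A

/-- `aᵢᵀ (Aᵀ W A)⁻¹ aᵢ`, where `aᵢ` is the `i`-th row of `A`. -/
def rowForm {m n : ℕ} (A : Matrix (Fin m) (Fin n) ℝ) (w : Fin m → ℝ) (i : Fin m) : ℝ :=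
  A i ⬝ᵥ ((gram A w)⁻¹ *ᵥ A i)

/-- The leverage score of the `i`-th row of `B`: the `i`-th diagonal entry of the orthogonal
projection `B (Bᵀ B)⁻¹ Bᵀ` onto the column space of `B`. -/
def leverageScore {m n : ℕ} (B : Matrix (Fin m) (Fin n) ℝ) (i : Fin m) : ℝ :=
  (B * (Bᵀ * B)⁻¹ * Bᵀ) i i

/-- `v` is the vector of `ℓ_p` Lewis weights of `A`:
`v_i ^ (2/p) = aᵢᵀ (Aᵀ V ^ (1 - 2/p) A)⁻¹ aᵢ` for all `i`, where the entries of `v` are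
nonnegative (so that the real powers make sense) and the matrix to be inverted is invertible. -/
def IsLewisWeights {m n : ℕ} (A : Matrix (Fin m) (Fin n) ℝ) (p : ℝ) (v : Fin m → ℝ) : Prop :=
  (∀ i, 0 ≤ v i) ∧
  IsUnit (gram A (fun j => v j ^ (1 - 2 / p))).det ∧
  ∀ i, v i ^ (2 / p) = rowForm A (fun j => v j ^ (1 - 2 / p)) i

/-- `a ≈_ε b`, that is, `(1 - ε) a ≤ b ≤ (1 + ε) a`. -/
def Approx (ε a b : ℝ) : Prop := (1 - ε) * a ≤ b ∧ b ≤ (1 + ε) * a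

/-- `α = 2 / (p - 2)`. -/
def alpha (p : ℝ) : ℝ := 2 / (p - 2)

/-- The objective `F(w) = - log det (Aᵀ W A) + (1 / (1 + α)) ∑ i, w_i ^ (1 + α)`. -/
def objective {m n : ℕ} (A : Matrix (Fin m) (Fin n) ℝ) (α : ℝ) (w : Fin m → ℝ) : ℝ :=
  - Real.log (gram A w).det + 1 / (1 + α) * ∑ i, w i ^ (1 + α)

/-! ## The algorithm -/

/-- `σ_i(w) = w_i aᵢᵀ (Aᵀ W A)⁻¹ aᵢ`. -/
def sigma {m n : ℕ} (A : Matrix (Fin m) (Fin n) ℝ) (w : Fin m → ℝ) (i : Fin m) : ℝ :=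
  w i * rowForm A w i

/-- `ρ_i(w) = σ_i(w) / w_i ^ (1 + α)`. -/
def rho {m n : ℕ} (A : Matrix (Fin m) (Fin n) ℝ) (α : ℝ) (w : Fin m → ℝ) (i : Fin m) : ℝ :=
  sigma A w i / w i ^ (1 + α)

/-- `Descent(w, [m], η)`. -/
def descent {m n : ℕ} (A : Matrix (Fin m) (Fin n) ℝ) (α : ℝ) (η w : Fin m → ℝ) : Fin m → ℝ :=
  fun i => w i * (1 + η i * ((rho A α w i - 1) / (rho A α w i + 1)))

/-- The equation of an exact coordinate minimization has exactly one solution `δ > -1`. -/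
theorem existsUnique_coordRoot {ρ σ α : ℝ} (hρ : 1 ≤ ρ) (hσ : 0 ≤ σ) (hσ1 : σ ≤ 1)
    (hα : 0 < α) : ∃! δ : ℝ, -1 < δ ∧ ρ = (1 + δ * σ) * (1 + δ) ^ α := by
  have hmono : StrictMonoOn (fun δ : ℝ => (1 + δ * σ) * (1 + δ) ^ α) (Set.Ioi (-1)) := by
    intro x hx y hy hxy
    have hx' : -1 < x := hx
    have hy' : -1 < y := hy
    have h1 : 0 < 1 + x * σ := by
      rcases hσ.eq_or_lt with h | h
      · simp [← h]
      · nlinarith [mul_pos h (by linarith : 0 < 1 + x)]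
    have h2 : 1 + x * σ ≤ 1 + y * σ := by nlinarith
    have h3 : (1 + x) ^ α < (1 + y) ^ α :=
      Real.rpow_lt_rpow (by linarith) (by linarith) hα
    have h4 : 0 < (1 + x) ^ α := Real.rpow_pos_of_pos (by linarith) α
    show (1 + x * σ) * (1 + x) ^ α < (1 + y * σ) * (1 + y) ^ α
    nlinarith
  have hcont : ContinuousOn (fun δ : ℝ => (1 + δ * σ) * (1 + δ) ^ α)
      (Set.Icc 0 (ρ ^ (1 / α))) := by
    apply ContinuousOn.mul (by fun_prop)
    exact ContinuousOn.rpow_const (by fun_prop) (fun x _ => Or.inr hα.le)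
  have hr : 0 ≤ ρ ^ (1 / α) := Real.rpow_nonneg (by linarith) _
  have hmem : ρ ∈ Set.Icc ((1 + 0 * σ) * (1 + 0) ^ α)
      ((1 + ρ ^ (1 / α) * σ) * (1 + ρ ^ (1 / α)) ^ α) := by
    refine ⟨by simpa using hρ, ?_⟩
    have h1 : ρ = (ρ ^ (1 / α)) ^ α := by
      rw [← Real.rpow_mul (by linarith), one_div_mul_cancel hα.ne', Real.rpow_one]
    have h2 : (ρ ^ (1 / α)) ^ α ≤ (1 + ρ ^ (1 / α)) ^ α :=
      Real.rpow_le_rpow hr (by linarith) hα.le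
    have h3 : 0 ≤ ρ ^ (1 / α) * σ := mul_nonneg hr hσ
    nlinarith
  obtain ⟨δ, hδ, hval⟩ := intermediate_value_Icc hr hcont hmem
  refine ⟨δ, ⟨by linarith [hδ.1], hval.symm⟩, ?_⟩
  rintro y ⟨hy, hyv⟩
  exact hmono.injOn hy (show -1 < δ by linarith [hδ.1]) (hyv.symm.trans hval.symm)

open Classical in
/-- The `δ > -1` that solves `ρ = (1 + δ σ) (1 + δ) ^ α`. -/
def coordRoot (ρ σ α : ℝ) : ℝ :=
  if h : ∃ δ : ℝ, -1 < δ ∧ ρ = (1 + δ * σ) * (1 + δ) ^ α then h.choose else 0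

/-- One coordinate step of `RoundSequential`: if `i` lies in `C = {i | ρ_i(w) ≥ 1}`, for the
current vector `w`, then `w_i` is replaced by `w_i (1 + δ_i)`. -/
def coordStep {m n : ℕ} (A : Matrix (Fin m) (Fin n) ℝ) (α : ℝ) (w : Fin m → ℝ) (i : Fin m) :
    Fin m → ℝ :=
  if 1 ≤ rho A α w i then
    Function.update w i (w i * (1 + coordRoot (rho A α w i) (sigma A w i) α))
  else w

/-- `RoundSequential(w, A, α)`: one pass of coordinate steps over the coordinates. -/
def roundSequential {m n : ℕ} (A : Matrix (Fin m) (Fin n) ℝ) (α : ℝ) (w : Fin m → ℝ) :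
    Fin m → ℝ :=
  (List.finRange m).foldl (coordStep A α) w

/-- The additive accuracy `α^8 ε^4 / (25 m (√n + α) (α + α⁻¹))^4`. -/
def tildeEps (m n : ℕ) (α ε : ℝ) : ℝ :=
  α ^ 8 * ε ^ 4 / (25 * m * (Real.sqrt n + α) * (α + 1 / α)) ^ 4

/-- The number `⌈c max(α⁻¹, α) log (m / ε̃)⌉` of rounds of the meta-algorithm. -/
def totalRounds (c m n : ℕ) (α ε : ℝ) : ℕ :=
  ⌈c * max (1 / α) α * Real.log (m / tildeEps m n α ε)⌉₊

/-- The vectors `w^(k)` of the meta-algorithm. -/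
def iterates {m n : ℕ} (A : Matrix (Fin m) (Fin n) ℝ) (α : ℝ) : ℕ → Fin m → ℝ
  | 0 => fun _ => (n : ℝ) / m
  | k + 1 =>
      descent A α (fun _ => 1 / (3 * max α 1)) (roundSequential A α (iterates A α k))

/-- The output of the meta-algorithm with `RoundSequential`. -/
def lewisOutput {m n : ℕ} (c : ℕ) (A : Matrix (Fin m) (Fin n) ℝ) (p ε : ℝ) : Fin m → ℝ :=
  fun i => rowForm A (roundSequential A (alpha p)
    (iterates A (alpha p) (totalRounds c m n (alpha p) ε))) i ^ (1 / alpha p)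

/-! ## A unit-cost real random access machine

Programs are written for an abstract type `R` of scalars, so that a program can act on scalars
only through the instructions below. Each instruction costs one step: it reads its operands from
memory and writes its result to memory. Every pass through a loop costs one further step. -/

/-- The scalar instructions: constants, arithmetic, elementary functions, and the solution of the
one-dimensional equation of a coordinate step. -/
inductive Instr (R : Type) : Type
  | const (k : ℕ) : Instr R
  | add (x y : R) : Instr R
  | sub (x y : R) : Instr R
  | mul (x y : R) : Instr R
  | div (x y : R) : Instr R
  | max (x y : R) : Instr R
  | sqrt (x : R) : Instr R
  | log (x : R) : Instr R
  | pow (x y : R) : Instr R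
  | root (ρ σ α : R) : Instr R

/-- The value of an instruction on real numbers. -/
def Instr.eval : Instr ℝ → ℝ
  | const k => k
  | add x y => x + y
  | sub x y => x - y
  | mul x y => x * y
  | div x y => x / y
  | max x y => Max.max x y
  | sqrt x => Real.sqrt x
  | log x => Real.log x
  | pow x y => x ^ y
  | root ρ σ α => coordRoot ρ σ α

/-- Programs over scalars `R` that report events in `E` and return a value in `X`. -/
inductive Prog (R E X : Type) : Type
  /-- return a value -/
  | ret (x : X) : Prog R E X
  /-- execute a scalar instruction -/
  | op (o : Instr R) (k : R → Prog R E X) : Prog R E X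
  /-- compare two scalars -/
  | le (x y : R) (k : Bool → Prog R E X) : Prog R E X
  /-- round a scalar up to a natural number -/
  | ceil (x : R) (k : ℕ → Prog R E X) : Prog R E X
  /-- one step of loop control -/
  | tick (k : Prog R E X) : Prog R E X
  /-- append an event to the record of the run -/
  | emit (e : E) (k : Prog R E X) : Prog R E X

namespace Prog

variable {R E X Y : Type}

/-- Sequential composition. -/
def seq : Prog R E X → (X → Prog R E Y) → Prog R E Y
  | ret x, f => f x
  | op o k, f => op o (fun r => seq (k r) f)
  | le x y k, f => le x y (fun b => seq (k b) f)
  | ceil x k, f => ceil x (fun j => seq (k j) f)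
  | tick k, f => tick (seq k f)
  | emit e k, f => emit e (seq k f)

instance : Monad (Prog R E) where
  pure := ret
  bind := seq

/-- The value returned by a run on real numbers. -/
def result : Prog ℝ E X → X
  | ret x => x
  | op o k => result (k o.eval)
  | le x y k => result (k (decide (x ≤ y)))
  | ceil x k => result (k ⌈x⌉₊)
  | tick k => result k
  | emit _ k => result k

/-- The number of steps of a run on real numbers. -/
def time : Prog ℝ E X → ℕ
  | ret _ => 0
  | op o k => time (k o.eval) + 1
  | le x y k => time (k (decide (x ≤ y))) + 1
  | ceil x k => time (k ⌈x⌉₊) + 1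
  | tick k => time k + 1
  | emit _ k => time k + 1

/-- The events reported by a run on real numbers, in their order. -/
def events : Prog ℝ E X → List E
  | ret _ => []
  | op o k => events (k o.eval)
  | le x y k => events (k (decide (x ≤ y)))
  | ceil x k => events (k ⌈x⌉₊)
  | tick k => events k
  | emit e k => e :: events k

/-- Execute one instruction. -/
def exec (o : Instr R) : Prog R E R := op o ret

/-- Test `x ≤ y`. -/
def test (x y : R) : Prog R E Bool := le x y ret

/-- Report an event. -/
def report (e : E) : Prog R E Unit := emit e (ret ())

/-- `for i = 0, …, k - 1`: replace the state `s` by the result of `f i s`. -/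
def loop : (k : ℕ) → (Fin k → X → Prog R E X) → X → Prog R E X
  | 0, _, s => ret s
  | k + 1, f, s => tick (seq (f 0 s) (fun t => loop k (fun i => f i.succ) t))

/-- Fill an array of length `k`. -/
def array : (k : ℕ) → (Fin k → Prog R E X) → Prog R E (Fin k → X)
  | 0, _ => ret Fin.elim0
  | k + 1, f => tick (seq (f 0) (fun x =>
      seq (array k (fun i => f i.succ)) (fun v => ret (Fin.cons x v))))

end Prog

/-! ## The implementation with Sherman–Morrison updates -/

/-- The record of one iteration: `score` was computed as the leverage score of row `row` of
`W^(1/2) A`, where `weights` is the diagonal of `W`. -/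
structure Iteration (m : ℕ) (R : Type) where
  weights : Fin m → R
  row : Fin m
  score : R

/-- The memory of the implementation: `w` and the matrix `(Aᵀ W A)⁻¹`. -/
structure Memory (m n : ℕ) (R : Type) where
  w : Fin m → R
  inv : Fin n → Fin n → R

namespace Prog

variable {R E : Type} {m n : ℕ}

/-- The inner product of two vectors. -/
def dot (u v : Fin n → R) : Prog R E R := do
  let z ← exec (.const 0)
  loop n (fun j s => do
    let t ← exec (.mul (u j) (v j))
    exec (.add s t)) z

/-- The product of a matrix and a vector. -/
def mulVec (N : Fin n → Fin n → R) (a : Fin n → R) : Prog R E (Fin n → R) :=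
  array n (fun i => dot (N i) a)

/-- The quadratic form `aᵀ N a`. -/
def quadForm (N : Fin n → Fin n → R) (a : Fin n → R) : Prog R E R := do
  let u ← mulVec N a
  dot a u

/-- The Sherman–Morrison formula: from `N = M⁻¹`, with `M` symmetric, compute
`(M + t a aᵀ)⁻¹ = N - (t / (1 + t aᵀ N a)) (N a) (N a)ᵀ`. -/
def shermanMorrison (N : Fin n → Fin n → R) (a : Fin n → R) (t : R) :
    Prog R E (Fin n → Fin n → R) := do
  let u ← mulVec N a
  let s ← dot a u
  let one ← exec (.const 1)
  let ts ← exec (.mul t s)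
  let d ← exec (.add one ts)
  let f ← exec (.div t d)
  array n (fun i => do
    let g ← exec (.mul f (u i))
    array n (fun j => do
      let h ← exec (.mul g (u j))
      exec (.sub (N i j) h)))

/-- Compute `(x Aᵀ A)⁻¹`: start from the identity matrix, add `x a_i a_iᵀ` for all rows `a_i` of
`A`, then subtract `e_j e_jᵀ` for all standard basis vectors `e_j`. -/
def initialInverse (A : Fin m → Fin n → R) (x : R) : Prog R E (Fin n → Fin n → R) := do
  let zero ← exec (.const 0)
  let one ← exec (.const 1)
  let negOne ← exec (.sub zero one)
  let id ← array n (fun i => array n (fun j => ret (if i = j then one else zero)))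
  let N ← loop m (fun i N => shermanMorrison N (A i) x) id
  loop n (fun j N => do
    let e ← array n (fun i => ret (if i = j then one else zero))
    shermanMorrison N e negOne) N

/-- One leverage score computation: returns `a_iᵀ (Aᵀ W A)⁻¹ a_i` and `σ_i(w)`. -/
def score (A : Fin m → Fin n → R) (s : Memory m n R) (i : Fin m) :
    Prog R (Iteration m R) (R × R) := do
  let q ← quadForm s.inv (A i)
  let σ ← exec (.mul (s.w i) q)
  report ⟨s.w, i, σ⟩
  return (q, σ)

/-- Compute `ρ_i(w)` from `σ_i(w)`. -/
def ratio (α : R) (s : Memory m n R) (i : Fin m) (σ : R) : Prog R E R := do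
  let one ← exec (.const 1)
  let e ← exec (.add one α)
  let z ← exec (.pow (s.w i) e)
  exec (.div σ z)

/-- Replace `w_i` by `x` and update the inverse matrix accordingly. -/
def setWeight (A : Fin m → Fin n → R) (s : Memory m n R) (i : Fin m) (x : R) :
    Prog R E (Memory m n R) := do
  let t ← exec (.sub x (s.w i))
  let N ← shermanMorrison s.inv (A i) t
  return ⟨Function.update s.w i x, N⟩

/-- `RoundSequential`. -/
def roundSequential (A : Fin m → Fin n → R) (α : R) (s : Memory m n R) :
    Prog R (Iteration m R) (Memory m n R) :=
  loop m (fun i s => do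
    let (_, σ) ← score A s i
    let ρ ← ratio α s i σ
    let one ← exec (.const 1)
    let b ← test one ρ
    if b then do
      let δ ← exec (.root ρ σ α)
      let f ← exec (.add one δ)
      let x ← exec (.mul (s.w i) f)
      setWeight A s i x
    else return s) s

/-- `Descent`, with all entries of the step size vector equal to `η`. -/
def descent (A : Fin m → Fin n → R) (α η : R) (s : Memory m n R) :
    Prog R (Iteration m R) (Memory m n R) := do
  let x ← array m (fun i => do
    let (_, σ) ← score A s i
    let ρ ← ratio α s i σ
    let one ← exec (.const 1)
    let a ← exec (.sub ρ one)
    let b ← exec (.add ρ one)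
    let r ← exec (.div a b)
    let t ← exec (.mul η r)
    let f ← exec (.add one t)
    exec (.mul (s.w i) f))
  loop m (fun i s => setWeight A s i (x i)) s

/-- Compute the number of rounds of the meta-algorithm. -/
def totalRounds (c m n : ℕ) (α ε : R) : Prog R E ℕ := do
  let one ← exec (.const 1)
  let four ← exec (.const 4)
  let eight ← exec (.const 8)
  let x1 ← exec (.pow α eight)
  let x2 ← exec (.pow ε four)
  let x3 ← exec (.mul x1 x2)
  let k ← exec (.const 25)
  let mm ← exec (.const m)
  let nn ← exec (.const n)
  let y1 ← exec (.mul k mm)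
  let y2 ← exec (.sqrt nn)
  let y3 ← exec (.add y2 α)
  let y4 ← exec (.mul y1 y3)
  let ai ← exec (.div one α)
  let y5 ← exec (.add α ai)
  let y6 ← exec (.mul y4 y5)
  let y7 ← exec (.pow y6 four)
  let e ← exec (.div x3 y7)
  let z1 ← exec (.div mm e)
  let z2 ← exec (.log z1)
  let cc ← exec (.const c)
  let z3 ← exec (.max ai α)
  let z4 ← exec (.mul cc z3)
  let z5 ← exec (.mul z4 z2)
  ceil z5 ret

/-- The meta-algorithm with `RoundSequential`, implemented with Sherman–Morrison updates. -/
def lewis (c : ℕ) (A : Fin m → Fin n → R) (p ε : R) :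
    Prog R (Iteration m R) (Fin m → R) := do
  let one ← exec (.const 1)
  let two ← exec (.const 2)
  let three ← exec (.const 3)
  let pm ← exec (.sub p two)
  let α ← exec (.div two pm)
  let αbar ← exec (.max α one)
  let d ← exec (.mul three αbar)
  let η ← exec (.div one d)
  let T ← totalRounds c m n α ε
  let nn ← exec (.const n)
  let mm ← exec (.const m)
  let x ← exec (.div nn mm)
  let w ← array m (fun _ => ret x)
  let N ← initialInverse A x
  let s ← loop T (fun _ s => do
    let t ← roundSequential A α s
    descent A α η t) ⟨w, N⟩
  let s ← roundSequential A α s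
  let a ← exec (.div one α)
  array m (fun i => do
    let (q, _) ← score A s i
    exec (.pow q a))

end Prog

end Lewis

end

noncomputable section

namespace Lewis

variable {m n : ℕ}

/-! ## Simultaneous diagonalization and the Gram matrices `Aᵀ W A` -/

/-! The substitution `w = v ^ (1 - 2 / p)` turns the Lewis weight equation into `w_i ^ α = rowForm A
w i`, the stationarity condition of the convex objective `F`. Since `p ≥ 4`, one has `0 < α ≤ 1`.

Comparisons of two weight vectors go through simultaneous diagonalization: in a suitable basis `Aᵀ W
A` becomes `1` and `Aᵀ U A` becomes `diagonal d` (`exists_relative_spectrum`). Then `F(u) - F(w)`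
equals `∑ (d_k - 1 - log d_k)` plus scalar terms (`exists_objective_sub_eq`). At a stationary `w`
all terms are nonnegative. This gives minimality and uniqueness, and also stability: a gap of at
most `κ²` forces `|√d_k - 1| ≤ κ`, so all quadratic forms agree up to `(1 - κ)²`
(`IsStationary.rowForm_close`).

Convergence is linear. Rounding never increases `F` and leaves `ρ_i ≤ 1` for all `i`: weights only
grow, quadratic forms only shrink, so a rounded coordinate stays rounded. Put `Q = ∑ w_i ^ (1 + α)
(1 - ρ_i)²`. At a rounded point the gap is at most `Q / α` (`objective_gap_le`), while a descent
step gains at least `Q / 12` (`descent_spec`). Hence each round multiplies the gap by at most `1 - α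
/ 12`. The initial gap is at most `2m`, so `c = 12` brings it below `(αε / 8)²`, which survives the
exponents `1 / α` and `p / (p - 2)` in the output.

Existence comes from maximizing `det` on a compact set and rescaling. For the running time,
`Prog.Runs` bounds result, steps and events of a program together; the memory always holds the exact
inverse, because every intermediate matrix is positive definite. There are `O(p log (mp / ε))`
rounds of `2m` scores and `O(m n²)` steps each. -/

theorem exists_orthogonal_diagonalization {X : Matrix (Fin n) (Fin n) ℝ} (hX : X.IsHermitian) :
    ∃ (U : Matrix (Fin n) (Fin n) ℝ) (d : Fin n → ℝ), Uᵀ * U = 1 ∧ Uᵀ * X * U = diagonal d := by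
  refine ⟨hX.eigenvectorUnitary, hX.eigenvalues, ?_, ?_⟩
  · simpa [star_eq_conjTranspose] using
      (Unitary.coe_star_mul_self hX.eigenvectorUnitary)
  · have h := hX.conjStarAlgAut_star_eigenvectorUnitary
    rw [Unitary.conjStarAlgAut_apply] at h
    simpa [star_eq_conjTranspose] using h

theorem exists_simultaneous_diagonalization {M N : Matrix (Fin n) (Fin n) ℝ} (hM : M.PosDef)
    (hN : N.IsHermitian) :
    ∃ (S : Matrix (Fin n) (Fin n) ℝ) (d : Fin n → ℝ),
      Sᵀ * M * S = 1 ∧ Sᵀ * N * S = diagonal d := by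
  obtain ⟨U, e, hU, hUM⟩ := exists_orthogonal_diagonalization hM.isHermitian
  have hUinj : Function.Injective U.mulVec := mulVec_injective_of_isUnit
    (IsUnit.of_mul_eq_one_right _ hU)
  have he : ∀ i, 0 < e i := by
    have h := hM.conjTranspose_mul_mul_same hUinj
    rw [conjTranspose_eq_transpose_of_trivial, hUM] at h
    exact posDef_diagonal_iff.1 h
  -- `R` whitens `M`; an orthogonal change of basis then diagonalizes `Rᵀ N R` without disturbing
  -- `Rᵀ M R = 1`.
  set R : Matrix (Fin n) (Fin n) ℝ := U * diagonal (fun i => 1 / Real.sqrt (e i)) with hR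
  have hRM : Rᵀ * M * R = 1 := by
    have : Rᵀ * M * R = diagonal (fun i => 1 / Real.sqrt (e i)) * (Uᵀ * M * U) *
        diagonal (fun i => 1 / Real.sqrt (e i)) := by
      simp only [hR, transpose_mul, diagonal_transpose, Matrix.mul_assoc]
    rw [this, hUM, diagonal_mul_diagonal, diagonal_mul_diagonal, ← diagonal_one]
    congr 1
    funext i
    have h1 := Real.sqrt_pos.2 (he i)
    have h2 := Real.mul_self_sqrt (he i).le
    field_simp
    nlinarith
  have hRN : (Rᵀ * N * R).IsHermitian := by
    have := isHermitian_conjTranspose_mul_mul R hN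
    rwa [conjTranspose_eq_transpose_of_trivial] at this
  obtain ⟨V, d, hV, hVN⟩ := exists_orthogonal_diagonalization hRN
  refine ⟨R * V, d, ?_, ?_⟩
  · calc (R * V)ᵀ * M * (R * V) = Vᵀ * (Rᵀ * M * R) * V := by
          simp only [transpose_mul, Matrix.mul_assoc]
      _ = 1 := by rw [hRM, Matrix.mul_one, hV]
  · rw [← hVN]
    simp only [transpose_mul, Matrix.mul_assoc]

theorem gram_apply (A : Matrix (Fin m) (Fin n) ℝ) (w : Fin m → ℝ) (k l : Fin n) :
    gram A w k l = ∑ i, w i * (A i k * A i l) := by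
  rw [gram, Matrix.mul_apply]
  exact Finset.sum_congr rfl fun i _ => by rw [mul_diagonal, transpose_apply]; ring

theorem gram_isHermitian (A : Matrix (Fin m) (Fin n) ℝ) (w : Fin m → ℝ) :
    (gram A w).IsHermitian := by
  ext k l
  simp only [conjTranspose_apply, star_trivial, gram_apply]
  exact Finset.sum_congr rfl fun i _ => by ring

theorem gram_posSemidef (A : Matrix (Fin m) (Fin n) ℝ) {w : Fin m → ℝ} (hw : ∀ i, 0 ≤ w i) :
    (gram A w).PosSemidef := by
  have := (PosSemidef.diagonal (show 0 ≤ w from hw)).conjTranspose_mul_mul_same A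
  rwa [conjTranspose_eq_transpose_of_trivial] at this

theorem gram_posDef_of_isUnit (A : Matrix (Fin m) (Fin n) ℝ) {w : Fin m → ℝ} (hw : ∀ i, 0 ≤ w i)
    (h : IsUnit (gram A w).det) : (gram A w).PosDef :=
  (gram_posSemidef A hw).posDef_iff_det_ne_zero.2 h.ne_zero

theorem mulVec_injective_of_rank {A : Matrix (Fin m) (Fin n) ℝ} (hA : A.rank = n) :
    Function.Injective A.mulVec := by
  rw [mulVec_injective_iff, linearIndependent_iff_card_eq_finrank_span, Fintype.card_fin,
    Set.finrank, ← rank_eq_finrank_span_cols, hA]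

theorem gram_posDef {A : Matrix (Fin m) (Fin n) ℝ} (hA : A.rank = n) {w : Fin m → ℝ}
    (hw : ∀ i, 0 < w i) : (gram A w).PosDef := by
  have := (posDef_diagonal_iff.2 hw).conjTranspose_mul_mul_same (mulVec_injective_of_rank hA)
  rwa [conjTranspose_eq_transpose_of_trivial] at this

theorem gram_update (A : Matrix (Fin m) (Fin n) ℝ) (w : Fin m → ℝ) (i : Fin m) (x : ℝ) :
    gram A (Function.update w i x) = gram A w + (x - w i) • vecMulVec (A i) (A i) := by
  ext k l
  simp only [gram_apply, Matrix.add_apply, Matrix.smul_apply, vecMulVec_apply, smul_eq_mul]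
  rw [← Finset.add_sum_erase _ _ (Finset.mem_univ i),
    ← Finset.add_sum_erase _ (fun i => w i * _) (Finset.mem_univ i)]
  rw [Finset.sum_congr rfl (fun j hj => by
    rw [Function.update_of_ne (Finset.ne_of_mem_erase hj)] :
    ∀ j ∈ Finset.univ.erase i, Function.update w i x j * (A j k * A j l) = w j * (A j k * A j l))]
  simp only [Function.update_self]
  ring

theorem gram_smul (A : Matrix (Fin m) (Fin n) ℝ) (s : ℝ) (w : Fin m → ℝ) :
    gram A (fun i => s * w i) = s • gram A w := by
  ext k l
  simp only [gram_apply, Matrix.smul_apply, smul_eq_mul, Finset.mul_sum]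
  exact Finset.sum_congr rfl fun i _ => by ring

/-- The spectrum of `Aᵀ U A` relative to `Aᵀ W A`. The matrix `G` is `A S`, where `S` diagonalizes
both matrices simultaneously. -/
theorem exists_relative_spectrum (A : Matrix (Fin m) (Fin n) ℝ) {w u : Fin m → ℝ}
    (hw : (gram A w).PosDef) (hu : (gram A u).PosDef) :
    ∃ (G : Fin m → Fin n → ℝ) (d : Fin n → ℝ), (∀ k, 0 < d k) ∧
      (∀ k, ∑ i, w i * G i k ^ 2 = 1) ∧ (∀ k, ∑ i, u i * G i k ^ 2 = d k) ∧
      (∀ i, rowForm A w i = ∑ k, G i k ^ 2) ∧ (∀ i, rowForm A u i = ∑ k, G i k ^ 2 / d k) ∧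
      Real.log (gram A u).det - Real.log (gram A w).det = ∑ k, Real.log (d k) := by
  obtain ⟨S, d, hS, hd⟩ := exists_simultaneous_diagonalization hw hu.isHermitian
  have hSunit : IsUnit S := IsUnit.of_mul_eq_one_right _ hS
  have hSinj : Function.Injective S.mulVec := mulVec_injective_of_isUnit hSunit
  have hdpos : ∀ k, 0 < d k := by
    have h := hu.conjTranspose_mul_mul_same hSinj
    rw [conjTranspose_eq_transpose_of_trivial, hd] at h
    exact posDef_diagonal_iff.1 h
  have hdet : S.det ≠ 0 := ((isUnit_iff_isUnit_det S).1 hSunit).ne_zero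
  have hgram : ∀ v : Fin m → ℝ, ∀ k, (Sᵀ * gram A v * S) k k = ∑ i, v i * (A * S) i k ^ 2 := by
    intro v k
    have : Sᵀ * gram A v * S = gram (A * S) v := by
      simp only [gram, transpose_mul, Matrix.mul_assoc]
    rw [this, gram_apply]
    exact Finset.sum_congr rfl fun i _ => by ring
  have hinv : ∀ {M : Matrix (Fin n) (Fin n) ℝ} {e : Fin n → ℝ}, (∀ k, 0 < e k) →
      Sᵀ * M * S = diagonal e → M⁻¹ = S * diagonal (fun k => (e k)⁻¹) * Sᵀ := by
    intro M e he h
    apply inv_eq_left_inv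
    have h1 : (diagonal (fun k => (e k)⁻¹) * Sᵀ * M) * S = 1 := by
      rw [Matrix.mul_assoc, Matrix.mul_assoc, ← Matrix.mul_assoc Sᵀ, h, diagonal_mul_diagonal,
        ← diagonal_one]
      congr 1
      funext k
      exact inv_mul_cancel₀ (he k).ne'
    have h2 := mul_eq_one_comm.1 h1
    simpa only [Matrix.mul_assoc] using h2
  have hrow : ∀ {v : Fin m → ℝ} {e : Fin n → ℝ}, (∀ k, 0 < e k) →
      Sᵀ * gram A v * S = diagonal e → ∀ i, rowForm A v i = ∑ k, (A * S) i k ^ 2 / e k := by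
    intro v e he h i
    have h1 : A i ᵥ* S = (A * S) i := rfl
    rw [rowForm, hinv he h, ← mulVec_mulVec, ← mulVec_mulVec, dotProduct_mulVec, mulVec_transpose,
      h1]
    simp only [dotProduct, mulVec_diagonal]
    exact Finset.sum_congr rfl fun k _ => by field_simp
  refine ⟨A * S, d, hdpos, ?_, ?_, ?_, hrow hdpos hd, ?_⟩
  · intro k
    rw [← hgram, hS, one_apply_eq]
  · intro k
    rw [← hgram, hd, diagonal_apply_eq]
  · intro i
    rw [hrow (e := fun _ => 1) (fun _ => one_pos) (by rw [hS, diagonal_one])]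
    simp
  · have h1 : S.det * (gram A w).det * S.det = 1 := by
      have h := congrArg det hS
      rwa [det_mul, det_mul, det_transpose, det_one] at h
    have h2 : S.det * (gram A u).det * S.det = ∏ k, d k := by
      rw [← det_diagonal, ← hd, det_mul, det_mul, det_transpose]
    have h3 : (gram A u).det = (∏ k, d k) * (gram A w).det := by
      have : (S.det * S.det) * (gram A u).det =
          (S.det * S.det) * ((∏ k, d k) * (gram A w).det) := by
        linear_combination h2 - (∏ k, d k) * h1
      exact mul_left_cancel₀ (mul_ne_zero hdet hdet) this
    rw [h3, Real.log_mul (Finset.prod_pos fun k _ => hdpos k).ne' hw.det_pos.ne',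
      Real.log_prod fun k _ => (hdpos k).ne']
    ring

theorem rowForm_nonneg {A : Matrix (Fin m) (Fin n) ℝ} {w : Fin m → ℝ} (hw : (gram A w).PosDef)
    (i : Fin m) : 0 ≤ rowForm A w i := by
  have := hw.inv.posSemidef.dotProduct_mulVec_nonneg (A i)
  rwa [star_trivial] at this

theorem rowForm_pos {A : Matrix (Fin m) (Fin n) ℝ} {w : Fin m → ℝ} (hw : (gram A w).PosDef)
    {i : Fin m} (hi : A i ≠ 0) : 0 < rowForm A w i := by
  have := hw.inv.dotProduct_mulVec_pos hi
  rwa [star_trivial] at this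

/-- The trace of a rank `n` projection: each of the `n` directions of the common basis contributes
`1`. -/
theorem sum_weight_mul_rowForm {A : Matrix (Fin m) (Fin n) ℝ} {w : Fin m → ℝ}
    (hw : (gram A w).PosDef) : ∑ i, w i * rowForm A w i = n := by
  obtain ⟨G, d, -, h1, -, h2, -⟩ := exists_relative_spectrum A hw hw
  simp only [h2, Finset.mul_sum]
  rw [Finset.sum_comm]
  simp [h1]

/-- Larger weights make every relative eigenvalue `d k` at least `1`. This monotonicity keeps
rounded coordinates rounded. -/
theorem rowForm_antitone {A : Matrix (Fin m) (Fin n) ℝ} {w u : Fin m → ℝ} (hw : (gram A w).PosDef)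
    (hu : (gram A u).PosDef) (hwu : ∀ i, w i ≤ u i) (i : Fin m) :
    rowForm A u i ≤ rowForm A w i := by
  obtain ⟨G, d, -, h1, h2, h3, h4, -⟩ := exists_relative_spectrum A hw hu
  rw [h3, h4]
  refine Finset.sum_le_sum fun k _ => div_le_self (sq_nonneg _) ?_
  rw [← h1 k, ← h2 k]
  exact Finset.sum_le_sum fun j _ => mul_le_mul_of_nonneg_right (hwu j) (sq_nonneg _)

/-- Convexity of `log det` in logarithmic coordinates. -/
theorem sum_mul_log_le_log_det_sub {A : Matrix (Fin m) (Fin n) ℝ} {w u : Fin m → ℝ}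
    (hA : A.rank = n) (hw : ∀ i, 0 < w i) (hu : ∀ i, 0 < u i) :
    ∑ i, w i * rowForm A w i * Real.log (u i / w i) ≤
      Real.log (gram A u).det - Real.log (gram A w).det := by
  obtain ⟨G, d, hd, h1, h2, h3, -, h5⟩ :=
    exists_relative_spectrum A (gram_posDef hA hw) (gram_posDef hA hu)
  rw [h5]
  have hlog : ∀ k, ∑ i, w i * G i k ^ 2 * Real.log (u i / w i) ≤ Real.log (d k) := by
    intro k
    -- Jensen for `log`: the numbers `w i * G i k ^ 2` are probabilities, and the mean of `u i / w
    -- i` under them is `d k`.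
    have h := strictConcaveOn_log_Ioi.concaveOn.le_map_sum (t := Finset.univ)
      (w := fun i => w i * G i k ^ 2) (p := fun i => u i / w i)
      (fun i _ => mul_nonneg (hw i).le (sq_nonneg _)) (h1 k)
      (fun i _ => div_pos (hu i) (hw i))
    simp only [smul_eq_mul] at h
    refine h.trans_eq ?_
    rw [← h2 k]
    congr 1
    refine Finset.sum_congr rfl fun i _ => ?_
    have := (hw i).ne'
    field_simp
  calc ∑ i, w i * rowForm A w i * Real.log (u i / w i)
      = ∑ k, ∑ i, w i * G i k ^ 2 * Real.log (u i / w i) := by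
        rw [Finset.sum_comm]
        refine Finset.sum_congr rfl fun i _ => ?_
        rw [h3, Finset.mul_sum, Finset.sum_mul]
    _ ≤ _ := Finset.sum_le_sum fun k _ => hlog k

/-! ## Rank-one updates -/

theorem det_add_smul_vecMulVec {M : Matrix (Fin n) (Fin n) ℝ} (a : Fin n → ℝ) (t : ℝ)
    (hM : IsUnit M.det) :
    (M + t • vecMulVec a a).det = M.det * (1 + t * (a ⬝ᵥ (M⁻¹ *ᵥ a))) := by
  have h := det_add_replicateCol_mul_replicateRow (ι := Unit) hM (t • a) a
  rw [← vecMulVec_eq, smul_vecMulVec] at h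
  rw [h]
  congr 1
  simp only [det_unique, Matrix.add_apply, one_apply_eq, Matrix.mul_apply, replicateRow_apply,
    replicateCol_apply, Pi.smul_apply, smul_eq_mul, dotProduct, mulVec]
  congr 1
  simp only [Finset.sum_mul, Finset.mul_sum]
  rw [Finset.sum_comm]
  exact Finset.sum_congr rfl fun i _ => Finset.sum_congr rfl fun j _ => by ring

/-- The Sherman–Morrison formula. -/
theorem inv_add_smul_vecMulVec {M : Matrix (Fin n) (Fin n) ℝ} (a : Fin n → ℝ) (t : ℝ)
    (hM : IsUnit M.det) (hs : M.IsHermitian) (h : 1 + t * (a ⬝ᵥ (M⁻¹ *ᵥ a)) ≠ 0) :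
    (M + t • vecMulVec a a)⁻¹ =
      M⁻¹ - (t / (1 + t * (a ⬝ᵥ (M⁻¹ *ᵥ a)))) • vecMulVec (M⁻¹ *ᵥ a) (M⁻¹ *ᵥ a) := by
  set u := M⁻¹ *ᵥ a with hu
  have hMu : M *ᵥ u = a := by rw [hu, mulVec_mulVec, mul_nonsing_inv _ hM, one_mulVec]
  have haM : a ᵥ* M⁻¹ = u := by
    have hsymm : (M⁻¹)ᵀ = M⁻¹ := by
      rw [transpose_nonsing_inv]
      congr 1
    rw [hu, ← vecMul_transpose, hsymm]
  apply inv_eq_right_inv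
  rw [Matrix.add_mul, Matrix.mul_sub, Matrix.mul_sub, mul_nonsing_inv _ hM, Matrix.mul_smul,
    mul_vecMulVec, hMu, Matrix.smul_mul, vecMulVec_mul, haM, Matrix.smul_mul, Matrix.mul_smul,
    vecMulVec_mul_vecMulVec]
  ext k l
  simp only [Matrix.add_apply, Matrix.sub_apply, Matrix.smul_apply, vecMulVec_apply, smul_eq_mul,
    Pi.smul_apply]
  field_simp
  ring

/-! ## Scalar inequalities -/

/-- Strict convexity of `x ^ (1 + a) / (1 + a)`, by Bernoulli's inequality for `x / y`. The boundary
value `y = 0` matters because zero rows have weight zero. -/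
theorem rpow_tangent_lt {a x y : ℝ} (ha : 0 < a) (hx : 0 ≤ x) (hy : 0 ≤ y) (hxy : x ≠ y) :
    y ^ a * (x - y) < (x ^ (1 + a) - y ^ (1 + a)) / (1 + a) := by
  have ha1 : 0 < 1 + a := by linarith
  rw [lt_div_iff₀ ha1]
  rcases hy.eq_or_lt with rfl | hy
  · have := Real.rpow_pos_of_pos (hx.lt_of_ne hxy.symm) (1 + a)
    rw [Real.zero_rpow ha.ne', Real.zero_rpow ha1.ne']
    linarith
  · have h := one_add_mul_self_lt_rpow_one_add (s := x / y - 1)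
      (by linarith [div_nonneg hx hy.le]) (by
        intro h
        exact hxy ((div_eq_one_iff_eq hy.ne').1 (by linarith))) (p := 1 + a) (by linarith)
    have hya := Real.rpow_pos_of_pos hy a
    rw [add_sub_cancel, Real.div_rpow hx hy.le, lt_div_iff₀ (Real.rpow_pos_of_pos hy _),
      Real.rpow_add hy, Real.rpow_one] at h
    rw [Real.rpow_add hy, Real.rpow_one]
    have h2 : (1 + (1 + a) * (x / y - 1)) * (y * y ^ a) =
        y * y ^ a + y ^ a * (x - y) * (1 + a) := by
      field_simp
    linarith

theorem rpow_tangent_le {a x y : ℝ} (ha : 0 < a) (hx : 0 ≤ x) (hy : 0 ≤ y) :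
    y ^ a * (x - y) ≤ (x ^ (1 + a) - y ^ (1 + a)) / (1 + a) := by
  by_cases h : x = y
  · simp [h]
  · exact (rpow_tangent_lt ha hx hy h).le

/-- Bernoulli with a quadratic gain: `t ^ a ≥ 1 + a log t`, and `-log t ≤ (t⁻¹ - t) / 2` because `x
≤ sinh x` for `x ≥ 0`. -/
theorem quadratic_le_rpow {a t : ℝ} (ha : 0 < a) (ht : 0 ≤ t) (ht1 : t ≤ 1) :
    1 - (1 + a) * (1 - t) + a / 2 * (1 - t) ^ 2 ≤ t ^ (1 + a) := by
  rcases ht.eq_or_lt with rfl | ht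
  · rw [Real.zero_rpow (by linarith)]
    nlinarith
  · have h1 : -Real.log t ≤ (t⁻¹ - t) / 2 := by
      have h := Real.sinh_log (inv_pos.2 ht)
      rw [Real.log_inv, inv_inv] at h
      rw [← h]
      exact Real.self_le_sinh_iff.2 (by linarith [Real.log_nonpos ht.le ht1])
    have h2 : 1 + a * Real.log t ≤ t ^ a := by
      rw [Real.rpow_def_of_pos ht]
      linarith [Real.add_one_le_exp (Real.log t * a)]
    have h3 : -(t * Real.log t) ≤ (1 - t ^ 2) / 2 := by
      have h := mul_le_mul_of_nonneg_left h1 ht.le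
      have h' : t * ((t⁻¹ - t) / 2) = (1 - t ^ 2) / 2 := by field_simp
      linarith
    rw [Real.rpow_add ht, Real.rpow_one]
    have h4 := mul_le_mul_of_nonneg_left h2 ht.le
    nlinarith

/-- One coordinate of the gap bound, with `r = ρ_i` and `t = u_i / w_i`. For `t ≥ 1` the left side
is nonpositive. For `t ≤ 1` the quadratic gain has coefficient `a / (2(1 + a)) ≥ a / 4`, and
completing the square in `1 - t` gives `(1 - r)² / a`. -/
theorem gap_term_le {a r t : ℝ} (ha : 0 < a) (ha1 : a ≤ 1) (ht : 0 ≤ t) (hr : r ≤ 1) :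
    r * (t - 1) - (t ^ (1 + a) - 1) / (1 + a) ≤ (1 - r) ^ 2 / a := by
  have hpos : 0 < 1 + a := by linarith
  have hsq : 0 ≤ (1 - r) ^ 2 / a := by positivity
  rcases le_total 1 t with h | h
  · have h1 := rpow_tangent_le ha ht zero_le_one
    rw [Real.one_rpow, Real.one_rpow] at h1
    nlinarith
  · have h1 := quadratic_le_rpow ha ht h
    have h2 : -(1 - t) + a / 4 * (1 - t) ^ 2 ≤ (t ^ (1 + a) - 1) / (1 + a) := by
      rw [le_div_iff₀ hpos]
      nlinarith [mul_nonneg (mul_nonneg ha.le (sub_nonneg.2 ha1)) (sq_nonneg (1 - t))]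
    have h3 : (1 - r) * (1 - t) - a / 4 * (1 - t) ^ 2 ≤ (1 - r) ^ 2 / a := by
      rw [le_div_iff₀ ha]
      nlinarith [sq_nonneg ((1 - r) - a / 2 * (1 - t))]
    linarith

/-- One coordinate of the descent gain, with relative decrease `d`. To second order the change is at
most `-(1 - r) d + (1 + 3r) d² / 2`. The step factor `1/3` makes the quadratic term at most half of
the linear one, and `d ≥ (1 - r) / 6` finishes. -/
theorem descent_term_le {a r d : ℝ} (ha : 0 < a) (ha1 : a ≤ 1) (hr : 0 ≤ r) (hr1 : r ≤ 1)
    (hd : d * (3 * (1 + r)) = 1 - r) :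
    ((1 - d) ^ (1 + a) - 1) / (1 + a) - r * Real.log (1 - d) ≤ -((1 - r) ^ 2 / 12) := by
  have hd0 : 0 ≤ d := by
    by_contra h
    nlinarith
  have hd3 : d ≤ 1 / 3 := by nlinarith
  have hpos : 0 < 1 - d := by linarith
  have h1 : (1 - d) ^ a ≤ 1 - a * d := by
    have := rpow_one_add_le_one_add_mul_self (s := -d) (by linarith) ha.le ha1
    rw [← sub_eq_add_neg] at this
    linarith
  have h2 : ((1 - d) ^ (1 + a) - 1) / (1 + a) ≤ -d + d ^ 2 / 2 := by
    rw [div_le_iff₀ (by linarith), Real.rpow_add hpos, Real.rpow_one]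
    have := mul_le_mul_of_nonneg_left h1 hpos.le
    nlinarith [mul_nonneg (sub_nonneg.2 ha1) (sq_nonneg d)]
  have h3 : -Real.log (1 - d) ≤ d + 3 / 2 * d ^ 2 := by
    have h := Real.log_le_sub_one_of_pos (inv_pos.2 hpos)
    rw [Real.log_inv] at h
    have : (1 - d)⁻¹ - 1 ≤ d + 3 / 2 * d ^ 2 := by
      rw [sub_le_iff_le_add, inv_le_iff_one_le_mul₀ hpos]
      nlinarith [mul_nonneg (sq_nonneg d) (by linarith : 0 ≤ 1 / 3 - d)]
    linarith
  have h4 := mul_le_mul_of_nonneg_left h3 hr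
  have h5 : d * (3 / 2 * r + 1 / 2) ≤ (1 - r) / 2 := by nlinarith
  have h6 := mul_le_mul_of_nonneg_left h5 hd0
  have h7 : (1 - r) / 6 ≤ d := by nlinarith
  have h8 := mul_le_mul_of_nonneg_left h7 (sub_nonneg.2 hr1)
  nlinarith

/-- Equivalent to `log √x ≤ √x - 1`. It turns an objective gap into a bound on a relative
eigenvalue. -/
theorem sq_sqrt_sub_one_le {x : ℝ} (hx : 0 < x) : (Real.sqrt x - 1) ^ 2 ≤ x - 1 - Real.log x := by
  have h1 := Real.log_le_sub_one_of_pos (Real.sqrt_pos.2 hx)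
  rw [Real.log_sqrt hx.le] at h1
  have h2 := Real.sq_sqrt hx.le
  nlinarith

/-! ## The objective -/

/-- The fixed point equation of the Lewis weights in the normalization of the convex program. -/
def IsStationary (A : Matrix (Fin m) (Fin n) ℝ) (α : ℝ) (w : Fin m → ℝ) : Prop :=
  (∀ i, 0 ≤ w i) ∧ IsUnit (gram A w).det ∧ ∀ i, w i ^ α = rowForm A w i

theorem IsStationary.posDef {A : Matrix (Fin m) (Fin n) ℝ} {α : ℝ} {w : Fin m → ℝ}
    (h : IsStationary A α w) : (gram A w).PosDef :=
  gram_posDef_of_isUnit A h.1 h.2.1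

/-- The linear terms cancel because `∑ rowForm A w i * (u i - w i) = ∑ (d k - 1)`, the derivative of
`log det` at `w`. -/
theorem exists_objective_sub_eq (A : Matrix (Fin m) (Fin n) ℝ) (α : ℝ) {w u : Fin m → ℝ}
    (hw : (gram A w).PosDef) (hu : (gram A u).PosDef) :
    ∃ (G : Fin m → Fin n → ℝ) (d : Fin n → ℝ), (∀ k, 0 < d k) ∧
      (∀ i, rowForm A w i = ∑ k, G i k ^ 2) ∧ (∀ i, rowForm A u i = ∑ k, G i k ^ 2 / d k) ∧
      objective A α u - objective A α w = ∑ k, (d k - 1 - Real.log (d k)) +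
        ∑ i, ((u i ^ (1 + α) - w i ^ (1 + α)) / (1 + α) - rowForm A w i * (u i - w i)) := by
  obtain ⟨G, d, hd, h1, h2, h3, h4, h5⟩ := exists_relative_spectrum A hw hu
  refine ⟨G, d, hd, h3, h4, ?_⟩
  have h6 : ∑ i, rowForm A w i * (u i - w i) = ∑ k, (d k - 1) := by
    simp only [h3, Finset.sum_mul]
    rw [Finset.sum_comm]
    refine Finset.sum_congr rfl fun k _ => ?_
    rw [← h1 k, ← h2 k, ← Finset.sum_sub_distrib]
    exact Finset.sum_congr rfl fun i _ => by ring
  rw [Finset.sum_sub_distrib, ← h6, ← h5, Finset.sum_sub_distrib, ← Finset.sum_div,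
    Finset.sum_sub_distrib, objective, objective]
  ring

/-- Only `-log det` is linearized; the power terms stay exact, so that they can be estimated one
coordinate at a time. -/
theorem objective_tangent_le {A : Matrix (Fin m) (Fin n) ℝ} (α : ℝ) {w u : Fin m → ℝ}
    (hw : (gram A w).PosDef) (hu : (gram A u).PosDef) :
    ∑ i, ((u i ^ (1 + α) - w i ^ (1 + α)) / (1 + α) - rowForm A w i * (u i - w i)) ≤
      objective A α u - objective A α w := by
  obtain ⟨G, d, hd, -, -, h⟩ := exists_objective_sub_eq A α hw hu
  rw [h]
  have : 0 ≤ ∑ k, (d k - 1 - Real.log (d k)) :=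
    Finset.sum_nonneg fun k _ => by linarith [Real.log_le_sub_one_of_pos (hd k)]
  linarith

theorem IsStationary.objective_lt {A : Matrix (Fin m) (Fin n) ℝ} {α : ℝ} (hα : 0 < α)
    {w u : Fin m → ℝ} (hw : IsStationary A α w) (hu : ∀ i, 0 ≤ u i) (hu' : (gram A u).PosDef)
    (hne : u ≠ w) : objective A α w < objective A α u := by
  have h := objective_tangent_le α hw.posDef hu'
  obtain ⟨i, hi⟩ := Function.ne_iff.1 hne
  have : 0 < ∑ i, ((u i ^ (1 + α) - w i ^ (1 + α)) / (1 + α) - rowForm A w i * (u i - w i)) := by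
    refine Finset.sum_pos' (fun j _ => ?_) ⟨i, Finset.mem_univ _, ?_⟩
    · rw [← hw.2.2]
      linarith [rpow_tangent_le hα (hu j) (hw.1 j)]
    · rw [← hw.2.2]
      linarith [rpow_tangent_lt hα (hu i) (hw.1 i) hi]
  linarith

theorem IsStationary.eq {A : Matrix (Fin m) (Fin n) ℝ} {α : ℝ} (hα : 0 < α)
    {w u : Fin m → ℝ} (hw : IsStationary A α w) (hu : IsStationary A α u) : u = w := by
  by_contra h
  exact lt_asymm (hw.objective_lt hα hu.1 hu.posDef h)
    (hu.objective_lt hα hw.1 hw.posDef (Ne.symm h))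

/-- A small optimality gap implies that all quadratic forms are multiplicatively close. -/
theorem IsStationary.rowForm_close {A : Matrix (Fin m) (Fin n) ℝ} {α κ : ℝ} (hα : 0 < α)
    (hκ : 0 ≤ κ) (hκ1 : κ < 1) {w u : Fin m → ℝ} (hw : IsStationary A α w) (hu : ∀ i, 0 ≤ u i)
    (hu' : (gram A u).PosDef) (h : objective A α u - objective A α w ≤ κ ^ 2) (i : Fin m) :
    (1 - κ) ^ 2 * rowForm A w i ≤ rowForm A u i ∧
      (1 - κ) ^ 2 * rowForm A u i ≤ rowForm A w i := by
  obtain ⟨G, d, hd, h3, h4, h5⟩ := exists_objective_sub_eq A α hw.posDef hu'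
  have h6 : 0 ≤ ∑ i, ((u i ^ (1 + α) - w i ^ (1 + α)) / (1 + α) - rowForm A w i * (u i - w i)) := by
    refine Finset.sum_nonneg fun j _ => ?_
    rw [← hw.2.2]
    linarith [rpow_tangent_le hα (hu j) (hw.1 j)]
  have h7 : ∀ k, |Real.sqrt (d k) - 1| ≤ κ := by
    intro k
    refine abs_le.2 (abs_le_of_sq_le_sq' ?_ hκ)
    refine (sq_sqrt_sub_one_le (hd k)).trans ?_
    have := Finset.single_le_sum (f := fun k => d k - 1 - Real.log (d k))
      (fun k _ => by linarith [Real.log_le_sub_one_of_pos (hd k)]) (Finset.mem_univ k)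
    linarith
  -- The second bound uses `(1 - κ) √d ≤ (1 - κ)(1 + κ) ≤ 1`.
  have h8 : ∀ k, (1 - κ) ^ 2 ≤ d k ∧ (1 - κ) ^ 2 * d k ≤ 1 := by
    intro k
    obtain ⟨h1, h2⟩ := abs_le.1 (h7 k)
    have hs := Real.sq_sqrt (hd k).le
    have hs0 := Real.sqrt_nonneg (d k)
    constructor
    · nlinarith
    · have h9 : (1 - κ) * Real.sqrt (d k) ≤ 1 := by nlinarith
      have h10 : 0 ≤ (1 - κ) * Real.sqrt (d k) := mul_nonneg (by linarith) hs0
      rw [← hs, ← mul_pow]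
      exact pow_le_one₀ h10 h9
  rw [h3, h4, Finset.mul_sum, Finset.mul_sum]
  constructor
  · refine Finset.sum_le_sum fun k _ => ?_
    rw [le_div_iff₀ (hd k)]
    nlinarith [mul_le_mul_of_nonneg_left (h8 k).2 (sq_nonneg (G i k))]
  · refine Finset.sum_le_sum fun k _ => ?_
    rw [← mul_div_assoc, div_le_iff₀ (hd k)]
    nlinarith [mul_le_mul_of_nonneg_left (h8 k).1 (sq_nonneg (G i k))]

/-! ## Coordinate steps and rounding -/

theorem sigma_nonneg {A : Matrix (Fin m) (Fin n) ℝ} (hA : A.rank = n) {w : Fin m → ℝ}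
    (hw : ∀ i, 0 < w i) (i : Fin m) : 0 ≤ sigma A w i :=
  mul_nonneg (hw i).le (rowForm_nonneg (gram_posDef hA hw) i)

theorem det_gram_update {A : Matrix (Fin m) (Fin n) ℝ} {w : Fin m → ℝ}
    (hw : IsUnit (gram A w).det) (i : Fin m) (x : ℝ) :
    (gram A (Function.update w i x)).det =
      (gram A w).det * (1 + (x - w i) * rowForm A w i) := by
  rw [gram_update, det_add_smul_vecMulVec _ _ hw, rowForm]

/-- Deleting the `i`-th weight leaves a positive semidefinite matrix, whose determinant is the old
one times `1 - w i * rowForm A w i`. -/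
theorem weight_mul_rowForm_le_one {A : Matrix (Fin m) (Fin n) ℝ} {w : Fin m → ℝ}
    (hw : (gram A w).PosDef) (hw0 : ∀ i, 0 ≤ w i) (i : Fin m) : w i * rowForm A w i ≤ 1 := by
  have h0 : ∀ j, 0 ≤ Function.update w i 0 j := by
    intro j
    by_cases h : j = i
    · subst h; simp
    · simpa [Function.update_of_ne h] using hw0 j
  have h1 := (gram_posSemidef A h0).det_nonneg
  rw [det_gram_update hw.det_pos.ne'.isUnit] at h1
  have := nonneg_of_mul_nonneg_right h1 hw.det_pos
  linarith

theorem rowForm_update_self {A : Matrix (Fin m) (Fin n) ℝ} {w : Fin m → ℝ}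
    (hw : IsUnit (gram A w).det) (i : Fin m) (x : ℝ) (h : 1 + (x - w i) * rowForm A w i ≠ 0) :
    rowForm A (Function.update w i x) i =
      rowForm A w i / (1 + (x - w i) * rowForm A w i) := by
  rw [rowForm, gram_update, inv_add_smul_vecMulVec _ _ hw (gram_isHermitian A w) h, sub_mulVec,
    smul_mulVec, vecMulVec_mulVec, dotProduct_sub]
  rw [dotProduct_smul, op_smul_eq_smul, dotProduct_smul, dotProduct_comm _ (A i)]
  change rowForm A w i - ((x - w i) / (1 + (x - w i) * rowForm A w i)) *
    (rowForm A w i * rowForm A w i) = _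
  generalize rowForm A w i = q at h ⊢
  generalize x - w i = t at h ⊢
  rw [eq_div_iff h, sub_mul, div_mul_eq_mul_div, div_mul_cancel₀ _ h]
  ring

theorem rho_eq {A : Matrix (Fin m) (Fin n) ℝ} (α : ℝ) {w : Fin m → ℝ} {i : Fin m} (hw : 0 < w i) :
    rho A α w i = rowForm A w i / w i ^ α := by
  rw [rho, sigma, Real.rpow_add hw, Real.rpow_one, mul_div_mul_left _ _ hw.ne']

/-- A negative root would make the product less than `1 ≤ ρ`. So coordinate steps never decrease a
weight. -/
theorem coordRoot_spec {ρ σ α : ℝ} (hρ : 1 ≤ ρ) (hσ : 0 ≤ σ) (hσ1 : σ ≤ 1) (hα : 0 < α) :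
    0 ≤ coordRoot ρ σ α ∧
      ρ = (1 + coordRoot ρ σ α * σ) * (1 + coordRoot ρ σ α) ^ α := by
  have hex := (existsUnique_coordRoot hρ hσ hσ1 hα).exists
  have hspec : -1 < coordRoot ρ σ α ∧
      ρ = (1 + coordRoot ρ σ α * σ) * (1 + coordRoot ρ σ α) ^ α := by
    rw [coordRoot, dif_pos hex]
    exact hex.choose_spec
  refine ⟨?_, hspec.2⟩
  by_contra! h
  have h1 : (1 + coordRoot ρ σ α) ^ α < 1 :=
    Real.rpow_lt_one (by linarith [hspec.1]) (by linarith) hα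
  have h2 : 0 ≤ (1 + coordRoot ρ σ α) ^ α := Real.rpow_nonneg (by linarith [hspec.1]) _
  have h3 : 1 + coordRoot ρ σ α * σ ≤ 1 := by nlinarith
  nlinarith [hspec.2]

section Steps

variable {A : Matrix (Fin m) (Fin n) ℝ} {α : ℝ}

theorem coordStep_spec (hA : A.rank = n) (hα : 0 < α) {w : Fin m → ℝ} (hw : ∀ i, 0 < w i)
    (i : Fin m) :
    (∀ j, w j ≤ coordStep A α w i j) ∧ objective A α (coordStep A α w i) ≤ objective A α w ∧
      rowForm A (coordStep A α w i) i ≤ coordStep A α w i i ^ α := by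
  have hPD := gram_posDef hA hw
  have hτ := rowForm_nonneg hPD i
  have hwα := Real.rpow_pos_of_pos (hw i) α
  by_cases hρ : 1 ≤ rho A α w i
  · rw [coordStep, if_pos hρ]
    obtain ⟨hδ, heq⟩ := coordRoot_spec hρ (sigma_nonneg hA hw i)
      (weight_mul_rowForm_le_one hPD (fun j => (hw j).le) i) hα
    set δ := coordRoot (rho A α w i) (sigma A w i) α
    have hle : ∀ j, w j ≤ Function.update w i (w i * (1 + δ)) j := by
      intro j
      by_cases h : j = i
      · subst h
        rw [Function.update_self]
        nlinarith [hw j]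
      · rw [Function.update_of_ne h]
    have hpos : ∀ j, 0 < Function.update w i (w i * (1 + δ)) j :=
      fun j => (hw j).trans_le (hle j)
    have hden : 1 + (w i * (1 + δ) - w i) * rowForm A w i = 1 + δ * sigma A w i := by
      rw [sigma]; ring
    have hden0 : 0 < 1 + δ * sigma A w i := by
      have := mul_nonneg hδ (sigma_nonneg hA hw i)
      linarith
    -- The equation for `δ` says exactly that `ρ_i = 1` after the update.
    have hnew : rowForm A (Function.update w i (w i * (1 + δ))) i = (w i * (1 + δ)) ^ α := by
      rw [rowForm_update_self hPD.det_pos.ne'.isUnit _ _ (by rw [hden]; exact hden0.ne'), hden,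
        div_eq_iff hden0.ne', Real.mul_rpow (hw i).le (by linarith)]
      rw [rho_eq α (hw i), div_eq_iff hwα.ne'] at heq
      rw [heq]
      ring
    refine ⟨hle, ?_, ?_⟩
    · have h := objective_tangent_le α (gram_posDef hA hpos) hPD
      have h0 : 0 ≤ ∑ j, ((w j ^ (1 + α) - Function.update w i (w i * (1 + δ)) j ^ (1 + α)) /
          (1 + α) - rowForm A (Function.update w i (w i * (1 + δ))) j *
            (w j - Function.update w i (w i * (1 + δ)) j)) := by
        refine Finset.sum_nonneg fun j _ => ?_
        by_cases hj : j = i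
        · subst hj
          rw [hnew, Function.update_self]
          linarith [rpow_tangent_le hα (hw j).le
            (by have := hpos j; rwa [Function.update_self] at this :
              0 < w j * (1 + δ)).le]
        · rw [Function.update_of_ne hj]
          simp
      linarith
    · rw [Function.update_self, hnew]
  · rw [coordStep, if_neg hρ]
    refine ⟨fun _ => le_rfl, le_rfl, ?_⟩
    rw [rho_eq α (hw i), le_div_iff₀ hwα] at hρ
    linarith

/-- The disjunction is the invariant of the pass: a coordinate is still to come or already rounded.
Later steps preserve the latter, since the form shrinks and the weight does not. -/
theorem foldl_coordStep_spec (hA : A.rank = n) (hα : 0 < α) (l : List (Fin m)) {w : Fin m → ℝ}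
    (hw : ∀ i, 0 < w i) :
    (∀ j, w j ≤ l.foldl (coordStep A α) w j) ∧
      objective A α (l.foldl (coordStep A α) w) ≤ objective A α w ∧
      ∀ j, (j ∈ l ∨ rowForm A w j ≤ w j ^ α) →
        rowForm A (l.foldl (coordStep A α) w) j ≤ l.foldl (coordStep A α) w j ^ α := by
  induction l generalizing w with
  | nil => simp
  | cons i l ih =>
    obtain ⟨h1, h2, h3⟩ := coordStep_spec hA hα hw i
    have hpos : ∀ j, 0 < coordStep A α w i j := fun j => (hw j).trans_le (h1 j)
    obtain ⟨h4, h5, h6⟩ := ih hpos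
    simp only [List.foldl_cons]
    refine ⟨fun j => (h1 j).trans (h4 j), h5.trans h2, fun j hj => h6 j ?_⟩
    by_cases hij : j = i
    · subst hij
      exact Or.inr h3
    · rcases hj with hj | hj
      · exact Or.inl ((List.mem_cons.1 hj).resolve_left hij)
      · refine Or.inr ?_
        calc rowForm A (coordStep A α w i) j ≤ rowForm A w j :=
              rowForm_antitone (gram_posDef hA hw) (gram_posDef hA hpos) h1 j
          _ ≤ w j ^ α := hj
          _ ≤ _ := Real.rpow_le_rpow (hw j).le (h1 j) hα.le

theorem roundSequential_spec (hA : A.rank = n) (hα : 0 < α) {w : Fin m → ℝ} (hw : ∀ i, 0 < w i) :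
    (∀ j, 0 < roundSequential A α w j) ∧
      objective A α (roundSequential A α w) ≤ objective A α w ∧
      ∀ j, rowForm A (roundSequential A α w) j ≤ roundSequential A α w j ^ α := by
  obtain ⟨h1, h2, h3⟩ := foldl_coordStep_spec hA hα (List.finRange m) hw
  exact ⟨fun j => (hw j).trans_le (h1 j), h2, fun j => h3 j (Or.inl (List.mem_finRange j))⟩

/-! ## Descent steps -/

theorem objective_gap_le (hA : A.rank = n) (hα : 0 < α) (hα1 : α ≤ 1) {w u : Fin m → ℝ} (hw
    : ∀ i, 0 < w i)
    (hround : ∀ i, rowForm A w i ≤ w i ^ α) (hu : ∀ i, 0 ≤ u i) (hu' : (gram A u).PosDef) :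
    objective A α w - objective A α u ≤
      (∑ i, w i ^ (1 + α) * (1 - rho A α w i) ^ 2) / α := by
  have h := objective_tangent_le α (gram_posDef hA hw) hu'
  have h1 : ∀ i, -((u i ^ (1 + α) - w i ^ (1 + α)) / (1 + α) - rowForm A w i * (u i - w i)) ≤
      w i ^ (1 + α) * (1 - rho A α w i) ^ 2 / α := by
    intro i
    have hwα := Real.rpow_pos_of_pos (hw i) α
    have hwα1 := Real.rpow_pos_of_pos (hw i) (1 + α)
    have hρ1 : rho A α w i ≤ 1 := by
      rw [rho_eq α (hw i), div_le_one hwα]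
      exact hround i
    have h2 := gap_term_le (t := u i / w i) hα hα1 (div_nonneg (hu i) (hw i).le) hρ1
    have h3 := mul_le_mul_of_nonneg_left h2 hwα1.le
    rw [← mul_div_assoc] at h3
    refine le_trans (le_of_eq ?_) h3
    rw [Real.div_rpow (hu i) (hw i).le, rho_eq α (hw i)]
    have h5 : w i ^ (1 + α) = w i * w i ^ α := by rw [Real.rpow_add (hw i), Real.rpow_one]
    have h6 := (hw i).ne'
    have h7 : 1 + α ≠ 0 := by linarith
    rw [h5]
    field_simp
    ring
  have h2 := Finset.sum_le_sum fun i (_ : i ∈ Finset.univ) => h1 i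
  rw [Finset.sum_neg_distrib, ← Finset.sum_div] at h2
  linarith

theorem descent_spec (hA : A.rank = n) (hα : 0 < α) (hα1 : α ≤ 1) {w : Fin m → ℝ} (hw
    : ∀ i, 0 < w i)
    (hround : ∀ i, rowForm A w i ≤ w i ^ α) :
    (∀ i, 0 < descent A α (fun _ => 1 / (3 * max α 1)) w i) ∧
      objective A α (descent A α (fun _ => 1 / (3 * max α 1)) w) - objective A α w ≤
        -((∑ i, w i ^ (1 + α) * (1 - rho A α w i) ^ 2) / 12) := by
  have hρ0 : ∀ i, 0 ≤ rho A α w i := fun i =>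
    div_nonneg (sigma_nonneg hA hw i) (Real.rpow_nonneg (hw i).le _)
  have hρ1 : ∀ i, rho A α w i ≤ 1 := fun i => by
    rw [rho_eq α (hw i), div_le_one (Real.rpow_pos_of_pos (hw i) α)]
    exact hround i
  set d : Fin m → ℝ := fun i => (1 - rho A α w i) / (3 * (1 + rho A α w i)) with hd
  have hd1 : ∀ i, d i * (3 * (1 + rho A α w i)) = 1 - rho A α w i := fun i =>
    div_mul_cancel₀ _ (by linarith [hρ0 i])
  have hd2 : ∀ i, d i < 1 := fun i => by
    rw [hd]
    simp only
    rw [div_lt_one (by linarith [hρ0 i])]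
    linarith [hρ0 i]
  have hdesc : ∀ i, descent A α (fun _ => 1 / (3 * max α 1)) w i = w i * (1 - d i) := by
    intro i
    have : rho A α w i + 1 ≠ 0 := by linarith [hρ0 i]
    rw [descent, max_eq_right hα1, hd]
    simp only
    rw [add_comm 1 (rho A α w i)]
    field_simp
    ring
  have hpos : ∀ i, 0 < descent A α (fun _ => 1 / (3 * max α 1)) w i := fun i => by
    rw [hdesc]
    exact mul_pos (hw i) (by linarith [hd2 i])
  refine ⟨hpos, ?_⟩
  -- An upper bound on `-log det` at the new point is needed, which ordinary convexity does not
  -- give; in logarithmic coordinates `-log det` is concave and its tangent bounds it from above.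
  have h := sum_mul_log_le_log_det_sub hA hw hpos
  set w' := descent A α (fun _ => 1 / (3 * max α 1)) w with hw'
  have h1 : ∀ i, (w' i ^ (1 + α) - w i ^ (1 + α)) / (1 + α) -
      w i * rowForm A w i * Real.log (w' i / w i) ≤
        -(w i ^ (1 + α) * (1 - rho A α w i) ^ 2 / 12) := by
    intro i
    have hwα1 := Real.rpow_pos_of_pos (hw i) (1 + α)
    have h2 := mul_le_mul_of_nonneg_left
      (descent_term_le hα hα1 (hρ0 i) (hρ1 i) (hd1 i)) hwα1.le
    have h3 : w i ^ (1 + α) * -((1 - rho A α w i) ^ 2 / 12) =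
        -(w i ^ (1 + α) * (1 - rho A α w i) ^ 2 / 12) := by ring
    rw [h3] at h2
    refine le_trans (le_of_eq ?_) h2
    have h4 : w i ^ (1 + α) * rho A α w i = w i * rowForm A w i := by
      rw [rho, sigma, mul_div_cancel₀ _ hwα1.ne']
    rw [hdesc, mul_div_cancel_left₀ _ (hw i).ne',
      Real.mul_rpow (hw i).le (by linarith [hd2 i]), ← h4]
    ring
  have h2 := Finset.sum_le_sum fun i (_ : i ∈ Finset.univ) => h1 i
  rw [Finset.sum_neg_distrib, Finset.sum_sub_distrib, ← Finset.sum_div, ← Finset.sum_div,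
    Finset.sum_sub_distrib] at h2
  rw [objective, objective]
  have h3 : 1 / (1 + α) * ∑ i, w' i ^ (1 + α) - 1 / (1 + α) * ∑ i, w i ^ (1 + α) =
      (∑ i, w' i ^ (1 + α) - ∑ i, w i ^ (1 + α)) / (1 + α) := by ring
  linarith

end Steps

/-! ## Existence of Lewis weights -/

theorem sum_comp_update (g : ℝ → ℝ) (w : Fin m → ℝ) (i : Fin m) (x : ℝ) :
    ∑ j, g (Function.update w i x j) = ∑ j, g (w j) + (g x - g (w i)) := by
  rw [← Finset.add_sum_erase _ _ (Finset.mem_univ i),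
    ← Finset.add_sum_erase _ (fun j => g (w j)) (Finset.mem_univ i), Function.update_self,
    Finset.sum_congr rfl fun j hj => by rw [Function.update_of_ne (Finset.ne_of_mem_erase hj)]]
  ring

theorem continuous_gram_det (A : Matrix (Fin m) (Fin n) ℝ) :
    Continuous fun w : Fin m → ℝ => (gram A w).det := by
  unfold gram
  fun_prop

theorem pos_of_rank {A : Matrix (Fin m) (Fin n) ℝ} (hn : 0 < n) (hA : A.rank = n) :
    0 < m ∧ n ≤ m := by
  have h : A.rank ≤ m := by simpa using A.rank_le_card_height
  omega

theorem exists_objective_minimizer {A : Matrix (Fin m) (Fin n) ℝ} (hn : 0 < n) (hA : A.rank = n)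
    {α : ℝ} (hα : 0 < α) :
    ∃ w : Fin m → ℝ, (∀ i, 0 ≤ w i) ∧ 0 < (gram A w).det ∧
      ∀ u : Fin m → ℝ, (∀ i, 0 ≤ u i) → 0 < (gram A u).det →
        objective A α w ≤ objective A α u := by
  obtain ⟨hm, hnm⟩ := pos_of_rank hn hA
  have hn1 : (1 : ℝ) ≤ n := by exact_mod_cast hn
  have hmR : (0 : ℝ) < m := by exact_mod_cast hm
  have hnmR : (n : ℝ) ≤ m := by exact_mod_cast hnm
  have hα1 : 0 < 1 + α := by linarith
  -- The bound `n` is the value of `∑ w_i ^ (1 + α)` at a stationary point, so no minimizer is cut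
  -- off.
  set K : Set (Fin m → ℝ) := {w | (∀ i, 0 ≤ w i) ∧ ∑ i, w i ^ (1 + α) ≤ n} with hK
  have hbound : K ⊆ Set.Icc 0 (fun _ => (n : ℝ)) := by
    rintro w ⟨h0, h1⟩
    refine ⟨h0, fun i => ?_⟩
    by_contra! h
    have h2 : w i ^ (1 + α) ≤ n := (Finset.single_le_sum
      (f := fun i => w i ^ (1 + α)) (fun i _ => Real.rpow_nonneg (h0 i) _)
      (Finset.mem_univ i)).trans h1
    have h3 : w i ^ (1 : ℝ) ≤ w i ^ (1 + α) :=
      Real.rpow_le_rpow_of_exponent_le (by linarith) (by linarith)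
    rw [Real.rpow_one] at h3
    linarith
  have hclosed : IsClosed K := by
    have h1 : IsClosed {w : Fin m → ℝ | ∀ i, 0 ≤ w i} := by
      simp only [Set.ofPred_forall]
      exact isClosed_iInter fun i => isClosed_le continuous_const (continuous_apply i)
    have h2 : Continuous fun w : Fin m → ℝ => ∑ i, w i ^ (1 + α) :=
      continuous_finsetSum _ fun i _ =>
        (Real.continuous_rpow_const hα1.le).comp (continuous_apply i)
    exact h1.inter (isClosed_le h2 continuous_const)
  have hcompact : IsCompact K := isCompact_Icc.of_isClosed_subset hclosed hbound
  have hw0 : (fun _ => (n : ℝ) / m) ∈ K := by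
    refine ⟨fun i => by positivity, ?_⟩
    have h1 : ((n : ℝ) / m) ^ (1 + α) ≤ ((n : ℝ) / m) ^ (1 : ℝ) :=
      Real.rpow_le_rpow_of_exponent_ge (by positivity) ((div_le_one hmR).2 hnmR) (by linarith)
    rw [Real.rpow_one] at h1
    rw [Finset.sum_const, Finset.card_univ, Fintype.card_fin, nsmul_eq_mul]
    calc (m : ℝ) * ((n : ℝ) / m) ^ (1 + α) ≤ m * (n / m) :=
          mul_le_mul_of_nonneg_left h1 hmR.le
      _ = n := by field_simp
  obtain ⟨w, hwK, hmax⟩ := hcompact.exists_isMaxOn ⟨_, hw0⟩ (continuous_gram_det A).continuousOn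
  have hdet : 0 < (gram A w).det :=
    (gram_posDef hA (w := fun _ => (n : ℝ) / m) fun _ => by positivity).det_pos.trans_le (hmax hw0)
  refine ⟨w, hwK.1, hdet, fun u hu hudet => ?_⟩
  have hS : 0 < ∑ i, u i ^ (1 + α) := by
    by_contra! h
    have h1 : ∀ i, u i = 0 := by
      intro i
      have h2 := (Finset.sum_eq_zero_iff_of_nonneg fun i _ => Real.rpow_nonneg (hu i) _).1
        (le_antisymm h (Finset.sum_nonneg fun i _ => Real.rpow_nonneg (hu i) _)) i
        (Finset.mem_univ i)
      exact ((Real.rpow_eq_zero_iff_of_nonneg (hu i)).1 h2).1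
    have h3 : gram A u = 0 := by
      ext k l
      simp [gram_apply, h1]
    have : Nonempty (Fin n) := ⟨⟨0, hn⟩⟩
    rw [h3, det_zero] at hudet
    exact lt_irrefl _ hudet
  set S := ∑ i, u i ^ (1 + α) with hSdef
  have hq : 0 < (n : ℝ) / S := by positivity
  -- An arbitrary `u` is scaled to the boundary of `K`. The determinant gains `s ^ n`, and `log (S /
  -- n) ≤ S / n - 1` pays for the change of the power sum.
  set s : ℝ := ((n : ℝ) / S) ^ (1 / (1 + α)) with hs
  have hs0 : 0 < s := Real.rpow_pos_of_pos hq _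
  have hs1 : s ^ (1 + α) = n / S := by
    rw [hs, ← Real.rpow_mul hq.le, one_div_mul_cancel hα1.ne', Real.rpow_one]
  have hsu : (fun i => s * u i) ∈ K := by
    refine ⟨fun i => mul_nonneg hs0.le (hu i), le_of_eq ?_⟩
    rw [Finset.sum_congr rfl fun i _ => Real.mul_rpow hs0.le (hu i), ← Finset.mul_sum, hs1,
      ← hSdef]
    field_simp
  have h1 : s ^ n * (gram A u).det ≤ (gram A w).det := by
    have h : (gram A fun i => s * u i).det ≤ (gram A w).det := hmax hsu
    rwa [gram_smul, det_smul, Fintype.card_fin] at h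
  have h2 := Real.log_le_log (by positivity) h1
  rw [Real.log_mul (by positivity) hudet.ne', Real.log_pow] at h2
  have h3 : (1 + α) * Real.log s = -Real.log (S / n) := by
    rw [← Real.log_rpow hs0, hs1, ← Real.log_inv, inv_div]
  have h4 := Real.log_le_sub_one_of_pos (show 0 < S / n by positivity)
  have h5 : (n : ℝ) * (S / n - 1) = S - n := by field_simp
  have h6 : (n : ℝ) - S ≤ (1 + α) * (n * Real.log s) := by nlinarith
  have h7 : 1 / (1 + α) * n - 1 / (1 + α) * S ≤ n * Real.log s := by
    rw [← mul_sub, one_div, inv_mul_le_iff₀ hα1]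
    exact h6
  have h8 : 1 / (1 + α) * ∑ i, w i ^ (1 + α) ≤ 1 / (1 + α) * n :=
    mul_le_mul_of_nonneg_left hwK.2 (by positivity)
  rw [objective, objective, ← hSdef]
  linarith

theorem exists_isStationary {A : Matrix (Fin m) (Fin n) ℝ} (hn : 0 < n) (hA : A.rank = n)
    {α : ℝ} (hα : 0 < α) : ∃ w, IsStationary A α w := by
  obtain ⟨w, hw0, hdet, hmin⟩ := exists_objective_minimizer hn hA hα
  have hPD := gram_posDef_of_isUnit A hw0 hdet.ne'.isUnit
  refine ⟨w, hw0, hdet.ne'.isUnit, fun i => ?_⟩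
  set τ := rowForm A w i with hτ
  have hτ0 : 0 ≤ τ := rowForm_nonneg hPD i
  -- Minimality along one coordinate, combined with `log D ≥ 1 - 1 / D`. Dividing by `x - w i` and
  -- letting `x → w i` replaces differentiation; the left limit is needed only when `w i > 0`.
  have key : ∀ x, 0 ≤ x → 0 < 1 + (x - w i) * τ →
      (x - w i) * τ ≤ x ^ α * (x - w i) * (1 + (x - w i) * τ) := by
    intro x hx hD
    have hu : ∀ j, 0 ≤ Function.update w i x j := by
      intro j
      by_cases h : j = i
      · subst h; simpa using hx
      · simpa [Function.update_of_ne h] using hw0 j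
    have hd : (gram A (Function.update w i x)).det = (gram A w).det * (1 + (x - w i) * τ) :=
      det_gram_update hdet.ne'.isUnit i x
    have h1 := hmin _ hu (by rw [hd]; positivity)
    rw [objective, objective, hd, Real.log_mul hdet.ne' hD.ne',
      sum_comp_update (fun y => y ^ (1 + α))] at h1
    have h2 := rpow_tangent_le hα (hw0 i) hx
    have h3 := Real.log_le_sub_one_of_pos (inv_pos.2 hD)
    rw [Real.log_inv] at h3
    have h4 : 1 - (1 + (x - w i) * τ)⁻¹ ≤ x ^ α * (x - w i) := by
      have h5 : 1 / (1 + α) * (∑ j, w j ^ (1 + α) + (x ^ (1 + α) - w i ^ (1 + α))) =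
        1 / (1 + α) * ∑ j, w j ^ (1 + α) - (w i ^ (1 + α) - x ^ (1 + α)) / (1 + α) := by ring
      linarith
    have h6 := mul_le_mul_of_nonneg_right h4 hD.le
    rw [sub_mul, inv_mul_cancel₀ hD.ne'] at h6
    linarith
  have hcont : Filter.Tendsto (fun x => x ^ α * (1 + (x - w i) * τ)) (nhds (w i))
      (nhds (w i ^ α)) := by
    have : Continuous fun x : ℝ => x ^ α * (1 + (x - w i) * τ) :=
      (Real.continuous_rpow_const hα.le).mul (by fun_prop)
    simpa using this.tendsto (w i)
  have hD : ∀ᶠ x in nhds (w i), 0 < 1 + (x - w i) * τ := by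
    have : Continuous fun x : ℝ => 1 + (x - w i) * τ := by fun_prop
    exact this.continuousAt.eventually_const_lt (by simp)
  apply le_antisymm
  · rcases (hw0 i).eq_or_lt with h | h
    · rw [← h, Real.zero_rpow hα.ne']
      exact hτ0
    · refine le_of_tendsto (hcont.mono_left (nhdsWithin_le_nhds (s := Set.Iio (w i)))) ?_
      filter_upwards [self_mem_nhdsWithin, nhdsWithin_le_nhds hD,
        nhdsWithin_le_nhds (lt_mem_nhds h)] with x hx1 hx2 hx3
      have h1 := key x hx3.le hx2
      have hx1' : x < w i := hx1
      nlinarith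
  · refine ge_of_tendsto (hcont.mono_left (nhdsWithin_le_nhds (s := Set.Ioi (w i)))) ?_
    filter_upwards [self_mem_nhdsWithin, nhdsWithin_le_nhds hD] with x hx1 hx2
    have hx1' : w i < x := hx1
    have h1 := key x ((hw0 i).trans hx1'.le) hx2
    nlinarith

/-! ## Lewis weights and stationary points -/

theorem IsLewisWeights.isStationary {A : Matrix (Fin m) (Fin n) ℝ} {p : ℝ} (hp : 4 ≤ p)
    {v : Fin m → ℝ} (hv : IsLewisWeights A p v) :
    IsStationary A (alpha p) fun i => v i ^ (1 - 2 / p) := by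
  refine ⟨fun i => Real.rpow_nonneg (hv.1 i) _, hv.2.1, fun i => ?_⟩
  rw [← hv.2.2 i, ← Real.rpow_mul (hv.1 i)]
  congr 1
  have h1 : p ≠ 0 := by linarith
  have h2 : p - 2 ≠ 0 := by linarith
  rw [alpha]
  field_simp

theorem rpow_conjugate {p x : ℝ} (hp : 4 ≤ p) (hx : 0 ≤ x) :
    (x ^ (p / (p - 2))) ^ (1 - 2 / p) = x := by
  rw [← Real.rpow_mul hx]
  have h1 : p ≠ 0 := by linarith
  have h2 : p - 2 ≠ 0 := by linarith
  have h3 : p / (p - 2) * (1 - 2 / p) = 1 := by field_simp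
  rw [h3, Real.rpow_one]

theorem rpow_conjugate' {p x : ℝ} (hp : 4 ≤ p) (hx : 0 ≤ x) :
    (x ^ (1 - 2 / p)) ^ (p / (p - 2)) = x := by
  rw [← Real.rpow_mul hx, mul_comm, Real.rpow_mul hx, rpow_conjugate hp hx]

theorem IsStationary.isLewisWeights {A : Matrix (Fin m) (Fin n) ℝ} {p : ℝ} (hp : 4 ≤ p)
    {w : Fin m → ℝ} (hw : IsStationary A (alpha p) w) :
    IsLewisWeights A p fun i => w i ^ (p / (p - 2)) := by
  have h : (fun i => (w i ^ (p / (p - 2))) ^ (1 - 2 / p)) = w :=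
    funext fun i => rpow_conjugate hp (hw.1 i)
  refine ⟨fun i => Real.rpow_nonneg (hw.1 i) _, ?_, fun i => ?_⟩
  · rw [h]
    exact hw.2.1
  · rw [h, ← hw.2.2 i, ← Real.rpow_mul (hw.1 i)]
    congr 1
    have h1 : p ≠ 0 := by linarith
    have h2 : p - 2 ≠ 0 := by linarith
    rw [alpha]
    field_simp

theorem alpha_pos {p : ℝ} (hp : 4 ≤ p) : 0 < alpha p := by
  rw [alpha]
  exact div_pos two_pos (by linarith)

theorem alpha_le_one {p : ℝ} (hp : 4 ≤ p) : alpha p ≤ 1 := by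
  rw [alpha, div_le_one (by linarith)]
  linarith

/-! ## Convergence -/

theorem iterates_pos {A : Matrix (Fin m) (Fin n) ℝ} (hn : 0 < n) (hA : A.rank = n) {α : ℝ}
    (hα : 0 < α) (hα1 : α ≤ 1) (k : ℕ) : ∀ i, 0 < iterates A α k i := by
  induction k with
  | zero =>
    intro i
    have hm : (0 : ℝ) < m := by exact_mod_cast (pos_of_rank hn hA).1
    have hn' : (0 : ℝ) < n := by exact_mod_cast hn
    exact div_pos hn' hm
  | succ k ih =>
    obtain ⟨h1, -, h3⟩ := roundSequential_spec hA hα ih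
    exact (descent_spec hA hα hα1 h1 h3).1

theorem IsStationary.le_one {A : Matrix (Fin m) (Fin n) ℝ} {α : ℝ} (hα : 0 < α) {w : Fin m → ℝ}
    (hw : IsStationary A α w) (i : Fin m) : w i ≤ 1 := by
  have h := weight_mul_rowForm_le_one hw.posDef hw.1 i
  rw [← hw.2.2 i] at h
  by_contra! h1
  have := Real.one_lt_rpow h1 hα
  nlinarith

/-- The tangent at the uniform vector loses at most `1 + τ_i` per coordinate, and `∑ τ_i = m`
because all weights are `n / m`. -/
theorem initial_gap_le {A : Matrix (Fin m) (Fin n) ℝ} (hn : 0 < n) (hA : A.rank = n) {α : ℝ}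
    (hα : 0 < α) {w : Fin m → ℝ} (hw : IsStationary A α w) :
    objective A α (fun _ => (n : ℝ) / m) - objective A α w ≤ 2 * m := by
  obtain ⟨hm, hnm⟩ := pos_of_rank hn hA
  have hn1 : (0 : ℝ) < n := by exact_mod_cast hn
  have hmR : (0 : ℝ) < m := by exact_mod_cast hm
  have hnmR : (n : ℝ) / m ≤ 1 := (div_le_one hmR).2 (by exact_mod_cast hnm)
  have hq : 0 < (n : ℝ) / m := by positivity
  have hPD := gram_posDef hA (w := fun _ : Fin m => (n : ℝ) / m) fun _ => hq
  have h := objective_tangent_le α hPD hw.posDef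
  have hsum := sum_weight_mul_rowForm hPD
  set τ := rowForm A (fun _ : Fin m => (n : ℝ) / m) with hτ
  have hτ0 : ∀ i, 0 ≤ τ i := rowForm_nonneg hPD
  have hτm : ∑ i, τ i = m := by
    rw [← Finset.mul_sum] at hsum
    field_simp at hsum
    exact hsum
  have h1 : ∀ i, -1 - τ i ≤
      (w i ^ (1 + α) - ((n : ℝ) / m) ^ (1 + α)) / (1 + α) - τ i * (w i - (n : ℝ) / m) := by
    intro i
    have h2 := Real.rpow_nonneg (hw.1 i) (1 + α)
    have h3 : ((n : ℝ) / m) ^ (1 + α) ≤ 1 := Real.rpow_le_one hq.le hnmR (by linarith)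
    have h4 : -1 ≤ (w i ^ (1 + α) - ((n : ℝ) / m) ^ (1 + α)) / (1 + α) := by
      rw [le_div_iff₀ (by linarith)]
      linarith
    have h5 : τ i * (w i - (n : ℝ) / m) ≤ τ i :=
      mul_le_of_le_one_right (hτ0 i) (by linarith [hw.le_one hα i])
    linarith
  have h2 := Finset.sum_le_sum fun i (_ : i ∈ Finset.univ) => h1 i
  rw [Finset.sum_sub_distrib, hτm, Finset.sum_const, Finset.card_univ, Fintype.card_fin,
    nsmul_eq_mul] at h2
  linarith

theorem iterates_gap_le {A : Matrix (Fin m) (Fin n) ℝ} (hn : 0 < n) (hA : A.rank = n) {α : ℝ}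
    (hα : 0 < α) (hα1 : α ≤ 1) {w : Fin m → ℝ} (hw : IsStationary A α w) (k : ℕ) :
    objective A α (iterates A α k) - objective A α w ≤ (1 - α / 12) ^ k * (2 * m) := by
  induction k with
  | zero =>
    rw [pow_zero, one_mul]
    exact initial_gap_le hn hA hα hw
  | succ k ih =>
    obtain ⟨h1, h2, h3⟩ := roundSequential_spec hA hα (iterates_pos hn hA hα hα1 k)
    have h4 := (descent_spec hA hα hα1 h1 h3).2
    have h5 := objective_gap_le hA hα hα1 h1 h3 hw.1 hw.posDef
    rw [le_div_iff₀ hα] at h5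
    rw [pow_succ, iterates]
    nlinarith

theorem tildeEps_pos {α ε : ℝ} (hm : 0 < m) (hα : 0 < α) (hε : 0 < ε) :
    0 < tildeEps m n α ε := by
  have : (0 : ℝ) < m := by exact_mod_cast hm
  rw [tildeEps]
  positivity

theorem two_mul_tildeEps_le {α ε : ℝ} (hm : 0 < m) (hn : 0 < n) (hα : 0 < α) (hα1 : α ≤ 1)
    (hε : 0 < ε) (hε1 : ε ≤ 1) : 2 * tildeEps m n α ε ≤ (α * ε / 8) ^ 2 := by
  have hmR : (1 : ℝ) ≤ m := by exact_mod_cast hm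
  have hn1 : 1 ≤ Real.sqrt n := Real.one_le_sqrt.2 (by exact_mod_cast hn)
  have h1 : 1 ≤ 1 / α := by rwa [le_div_iff₀ hα, one_mul]
  have hbase : 25 ≤ 25 * (m : ℝ) * (Real.sqrt n + α) * (α + 1 / α) := by
    have h2 : 1 ≤ (m : ℝ) * (Real.sqrt n + α) := one_le_mul_of_one_le_of_one_le hmR (by linarith)
    have h3 := one_le_mul_of_one_le_of_one_le h2 (show 1 ≤ α + 1 / α by linarith)
    linarith
  have h4 : (25 : ℝ) ^ 4 ≤ (25 * (m : ℝ) * (Real.sqrt n + α) * (α + 1 / α)) ^ 4 :=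
    pow_le_pow_left₀ (by norm_num) hbase 4
  have h5 : α ^ 8 * ε ^ 4 ≤ α ^ 2 * ε ^ 2 :=
    mul_le_mul (pow_le_pow_of_le_one hα.le hα1 (by norm_num))
      (pow_le_pow_of_le_one hε.le hε1 (by norm_num)) (by positivity) (by positivity)
  have h6 : tildeEps m n α ε ≤ α ^ 2 * ε ^ 2 / 25 ^ 4 :=
    div_le_div₀ (by positivity) h5 (by norm_num) h4
  have h7 : 0 < α ^ 2 * ε ^ 2 := by positivity
  have h8 : (α * ε / 8) ^ 2 = α ^ 2 * ε ^ 2 / 64 := by ring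
  rw [h8]
  linarith

theorem one_le_div_tildeEps {α ε : ℝ} (hm : 0 < m) (hn : 0 < n) (hα : 0 < α) (hα1 : α ≤ 1)
    (hε : 0 < ε) (hε1 : ε ≤ 1) : 1 ≤ m / tildeEps m n α ε := by
  have hmR : (1 : ℝ) ≤ m := by exact_mod_cast hm
  have h := two_mul_tildeEps_le (m := m) (n := n) hm hn hα hα1 hε hε1
  have h1 : (α * ε / 8) ^ 2 ≤ 1 := by
    have h2 : α * ε ≤ 1 := mul_le_one₀ hα1 hε.le hε1
    have h3 : 0 ≤ α * ε := by positivity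
    exact pow_le_one₀ (by positivity) (by linarith)
  rw [le_div_iff₀ (tildeEps_pos hm hα hε)]
  linarith [tildeEps_pos (m := m) (n := n) hm hα hε]

/-- The constant `12` cancels the rate `α / 12`, so the contraction factor is at most `ε̃ / m`. -/
theorem rate_pow_totalRounds_le {α ε : ℝ} (hm : 0 < m) (hn : 0 < n) (hα : 0 < α) (hα1 : α ≤ 1)
    (hε : 0 < ε) (hε1 : ε ≤ 1) :
    (1 - α / 12) ^ totalRounds 12 m n α ε * (2 * m) ≤ (α * ε / 8) ^ 2 := by
  have hmR : (0 : ℝ) < m := by exact_mod_cast hm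
  have hE := tildeEps_pos (m := m) (n := n) hm hα hε
  have hlog := Real.log_nonneg (one_le_div_tildeEps (m := m) (n := n) hm hn hα hα1 hε hε1)
  have hT : 12 * max (1 / α) α * Real.log (m / tildeEps m n α ε) ≤ totalRounds 12 m n α ε := by
    have := Nat.le_ceil ((12 : ℕ) * max (1 / α) α * Real.log (m / tildeEps m n α ε))
    rw [totalRounds]
    exact_mod_cast this
  have h1 : Real.log (m / tildeEps m n α ε) ≤ totalRounds 12 m n α ε * (α / 12) := by
    have h2 : 12 * (1 / α) * Real.log (m / tildeEps m n α ε) ≤ totalRounds 12 m n α ε :=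
      le_trans (mul_le_mul_of_nonneg_right
        (mul_le_mul_of_nonneg_left (le_max_left _ _) (by norm_num)) hlog) hT
    calc Real.log (m / tildeEps m n α ε)
        = 12 * (1 / α) * Real.log (m / tildeEps m n α ε) * (α / 12) := by field_simp
      _ ≤ _ := mul_le_mul_of_nonneg_right h2 (by positivity)
  have h2 : (1 - α / 12) ^ totalRounds 12 m n α ε ≤ tildeEps m n α ε / m := by
    calc (1 - α / 12) ^ totalRounds 12 m n α ε
        ≤ Real.exp (-(α / 12)) ^ totalRounds 12 m n α ε :=
          pow_le_pow_left₀ (by linarith) (Real.one_sub_le_exp_neg _) _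
      _ = Real.exp (-(totalRounds 12 m n α ε * (α / 12))) := by
          rw [← Real.exp_nat_mul]; congr 1; ring
      _ ≤ Real.exp (-Real.log (m / tildeEps m n α ε)) :=
          Real.exp_le_exp.2 (by linarith)
      _ = _ := by rw [← Real.log_inv, inv_div, Real.exp_log (by positivity)]
  calc (1 - α / 12) ^ totalRounds 12 m n α ε * (2 * m)
      ≤ tildeEps m n α ε / m * (2 * m) := mul_le_mul_of_nonneg_right h2 (by positivity)
    _ = 2 * tildeEps m n α ε := by field_simp
    _ ≤ _ := two_mul_tildeEps_le hm hn hα hα1 hε hε1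

theorem approx_rpow {α ε q x y : ℝ} (hα : 0 < α) (hα1 : α ≤ 1) (hε : 0 < ε) (hε1 : ε ≤ 1)
    (hq : 0 ≤ q) (hqα : q ≤ 2 / α) (hx : 0 ≤ x) (hy : 0 ≤ y)
    (hxy : (1 - α * ε / 8) ^ 2 * x ≤ y) (hyx : (1 - α * ε / 8) ^ 2 * y ≤ x) :
    Approx ε (x ^ q) (y ^ q) := by
  have hαε : α * ε ≤ 1 := mul_le_one₀ hα1 hε.le hε1
  have hαε0 : 0 < α * ε := by positivity
  set κ := α * ε / 8 with hκ
  have hb : 0 < 1 - κ := by linarith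
  -- The exponent of `1 - κ` is at most `4 / α`, so `κ = αε / 8` loses `ε / 2` by Bernoulli. The
  -- upper bound then uses `(1 + ε)(1 - ε / 2) ≥ 1`.
  have hfac : 1 - ε / 2 ≤ ((1 - κ) ^ 2) ^ q := by
    have h1 : ((1 - κ) ^ 2) ^ q = (1 - κ) ^ (2 * q) := by
      rw [Real.rpow_mul hb.le, Real.rpow_two]
    have h2 : (1 - κ) ^ (4 / α) ≤ (1 - κ) ^ (2 * q) := by
      refine Real.rpow_le_rpow_of_exponent_ge hb (by linarith) ?_
      calc 2 * q ≤ 2 * (2 / α) := by linarith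
        _ = 4 / α := by ring
    have h3 := one_add_mul_self_le_rpow_one_add (s := -κ) (by linarith) (p := 4 / α)
      (by rw [le_div_iff₀ hα]; linarith)
    rw [← sub_eq_add_neg] at h3
    have h4 : 1 + 4 / α * -κ = 1 - ε / 2 := by
      rw [hκ]
      field_simp
      ring
    rw [h1]
    linarith
  have hxq := Real.rpow_nonneg hx q
  have hyq := Real.rpow_nonneg hy q
  have h1 := Real.rpow_le_rpow (by positivity) hxy hq
  have h2 := Real.rpow_le_rpow (by positivity) hyx hq
  rw [Real.mul_rpow (by positivity) hx] at h1
  rw [Real.mul_rpow (by positivity) hy] at h2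
  have h3 := mul_le_mul_of_nonneg_right hfac hxq
  have h4 := mul_le_mul_of_nonneg_right hfac hyq
  constructor
  · nlinarith
  · have h5 : (1 - ε / 2) * y ^ q ≤ x ^ q := h4.trans h2
    have h6 : 0 ≤ ε * (1 - ε) * y ^ q :=
      mul_nonneg (mul_nonneg hε.le (by linarith)) hyq
    have h7 := mul_le_mul_of_nonneg_left h5 (by linarith : 0 ≤ 1 + ε)
    nlinarith

/-- The exponent `q` serves both normalizations: `q = 1`, and `q = p / (p - 2) ≤ 2`. -/
theorem lewisOutput_close {A : Matrix (Fin m) (Fin n) ℝ} {p ε : ℝ} (hn : 0 < n) (hA : A.rank = n)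
    (hp : 4 ≤ p) (hε : 0 < ε) (hε1 : ε ≤ 1) {w : Fin m → ℝ} (hw : IsStationary A (alpha p) w)
    {q : ℝ} (hq : 0 ≤ q) (hq2 : q ≤ 2) (i : Fin m) :
    Approx ε (lewisOutput 12 A p ε i ^ q) (w i ^ q) := by
  have hα := alpha_pos hp
  have hα1 := alpha_le_one hp
  set α := alpha p with hαdef
  obtain ⟨h1, h2, -⟩ := roundSequential_spec hA hα
    (iterates_pos hn hA hα hα1 (totalRounds 12 m n α ε))
  have hPD := gram_posDef hA h1
  have hgap := (iterates_gap_le hn hA hα hα1 hw (totalRounds 12 m n α ε)).trans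
    (rate_pow_totalRounds_le (pos_of_rank hn hA).1 hn hα hα1 hε hε1)
  have hαε : α * ε ≤ 1 := mul_le_one₀ hα1 hε.le hε1
  obtain ⟨h3, h4⟩ := hw.rowForm_close hα (by positivity) (by linarith : α * ε / 8 < 1)
    (fun i => (h1 i).le) hPD (by linarith) i
  have hw1 : w i = rowForm A w i ^ (1 / α) := by
    rw [← hw.2.2 i, ← Real.rpow_mul (hw.1 i), mul_one_div_cancel hα.ne', Real.rpow_one]
  rw [lewisOutput, ← hαdef, hw1, ← Real.rpow_mul (rowForm_nonneg hPD i),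
    ← Real.rpow_mul (rowForm_nonneg hw.posDef i)]
  refine approx_rpow hα hα1 hε hε1 (by positivity) ?_ (rowForm_nonneg hPD i)
    (rowForm_nonneg hw.posDef i) h4 h3
  calc 1 / α * q ≤ 1 / α * 2 := mul_le_mul_of_nonneg_left hq2 (by positivity)
    _ = 2 / α := by ring

theorem lewisOutput_spec {A : Matrix (Fin m) (Fin n) ℝ} {p ε : ℝ} (hn : 0 < n) (hA : A.rank = n)
    (hp : 4 ≤ p) (hε : 0 < ε) (hε1 : ε ≤ 1) :
    ∃ v : Fin m → ℝ, IsLewisWeights A p v ∧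
      (∀ u : Fin m → ℝ, IsLewisWeights A p u → u = v) ∧
      (∀ i, Approx ε (lewisOutput 12 A p ε i) (v i ^ (1 - 2 / p))) ∧
      (∀ i, Approx ε (lewisOutput 12 A p ε i ^ (p / (p - 2))) (v i)) ∧
      ((∀ i, A i ≠ 0) →
        (∀ i, 0 < lewisOutput 12 A p ε i) ∧
        (∀ i, 0 < v i) ∧
        ∀ w : Fin m → ℝ, (∀ i, 0 < w i) → w ≠ (fun i => v i ^ (1 - 2 / p)) →
          objective A (alpha p) (fun i => v i ^ (1 - 2 / p)) < objective A (alpha p) w) := by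
  have hα := alpha_pos hp
  have hα1 := alpha_le_one hp
  obtain ⟨w, hw⟩ := exists_isStationary hn hA hα
  have hconj : (fun i => (w i ^ (p / (p - 2))) ^ (1 - 2 / p)) = w :=
    funext fun i => rpow_conjugate hp (hw.1 i)
  have hp2 : 0 < p - 2 := by linarith
  refine ⟨fun i => w i ^ (p / (p - 2)), hw.isLewisWeights hp, ?_, ?_, ?_, ?_⟩
  · intro u hu
    have h := hw.eq hα (hu.isStationary hp)
    funext i
    rw [← h]
    exact (rpow_conjugate' hp (hu.1 i)).symm
  · intro i
    rw [rpow_conjugate hp (hw.1 i)]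
    simpa using lewisOutput_close hn hA hp hε hε1 hw zero_le_one one_le_two i
  · intro i
    refine lewisOutput_close hn hA hp hε hε1 hw (by positivity) ?_ i
    rw [div_le_iff₀ hp2]
    linarith
  · intro hrows
    rw [hconj]
    refine ⟨fun i => ?_, fun i => ?_, fun u hu hne => ?_⟩
    · obtain ⟨h1, -, -⟩ := roundSequential_spec hA hα
        (iterates_pos hn hA hα hα1 (totalRounds 12 m n (alpha p) ε))
      exact Real.rpow_pos_of_pos (rowForm_pos (gram_posDef hA h1) (hrows i)) _
    · have h := rowForm_pos hw.posDef (hrows i)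
      rw [← hw.2.2 i] at h
      refine Real.rpow_pos_of_pos ((hw.1 i).lt_of_ne fun h0 => ?_) _
      rw [← h0, Real.zero_rpow hα.ne'] at h
      exact lt_irrefl _ h
    · exact hw.objective_lt hα (fun i => (hu i).le) (gram_posDef hA hu) hne

/-! ## Runs of programs -/

namespace Prog

variable {E X Y : Type} {m n : ℕ}

/-- A run of the program returns `x` after at most `t` steps and reports at most `k` events, all of
which satisfy `Good`. -/
structure Runs (Good : E → Prop) (P : Prog ℝ E X) (x : X) (t k : ℕ) : Prop where
  result_eq : P.result = x
  time_le : P.time ≤ t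
  length_le : P.events.length ≤ k
  good : ∀ e ∈ P.events, Good e

variable {Good : E → Prop}

theorem result_seq (P : Prog ℝ E X) (f : X → Prog ℝ E Y) :
    (P.seq f).result = (f P.result).result := by
  induction P with
  | ret x => rfl
  | op o k ih => exact ih _
  | le x y k ih => exact ih _
  | ceil x k ih => exact ih _
  | tick k ih => exact ih
  | emit e k ih => exact ih

theorem time_seq (P : Prog ℝ E X) (f : X → Prog ℝ E Y) :
    (P.seq f).time = P.time + (f P.result).time := by
  induction P with
  | ret x => simp [seq, time, result]
  | op o k ih => simp only [seq, time, result, ih]; omega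
  | le x y k ih => simp only [seq, time, result, ih]; omega
  | ceil x k ih => simp only [seq, time, result, ih]; omega
  | tick k ih => simp only [seq, time, result, ih]; omega
  | emit e k ih => simp only [seq, time, result, ih]; omega

theorem events_seq (P : Prog ℝ E X) (f : X → Prog ℝ E Y) :
    (P.seq f).events = P.events ++ (f P.result).events := by
  induction P with
  | ret x => simp [seq, events, result]
  | op o k ih => simp only [seq, events, result, ih]
  | le x y k ih => simp only [seq, events, result, ih]
  | ceil x k ih => simp only [seq, events, result, ih]
  | tick k ih => simp only [seq, events, result, ih]
  | emit e k ih => simp only [seq, events, result, ih, List.cons_append]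

theorem Runs.mono {P : Prog ℝ E X} {x : X} {t t' k k' : ℕ} (h : Runs Good P x t k) (ht : t ≤ t')
    (hk : k ≤ k') : Runs Good P x t' k' :=
  ⟨h.1, h.2.trans ht, h.3.trans hk, h.4⟩

theorem Runs.congr {P : Prog ℝ E X} {x y : X} {t k : ℕ} (h : Runs Good P x t k) (hxy : x = y) :
    Runs Good P y t k :=
  hxy ▸ h

theorem Runs.ret (x : X) : Runs Good (Prog.ret x : Prog ℝ E X) x 0 0 :=
  ⟨rfl, le_rfl, le_rfl, by simp [events]⟩

theorem Runs.pure (x : X) : Runs Good (Pure.pure x : Prog ℝ E X) x 0 0 :=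
  Runs.ret x

theorem Runs.exec (o : Instr ℝ) : Runs Good (Prog.exec o : Prog ℝ E ℝ) o.eval 1 0 :=
  ⟨rfl, le_rfl, le_rfl, by simp [events, Prog.exec]⟩

theorem Runs.tick {P : Prog ℝ E X} {x : X} {t k : ℕ} (h : Runs Good P x t k) :
    Runs Good (Prog.tick P) x (t + 1) k :=
  ⟨h.1, Nat.succ_le_succ h.2, h.3, h.4⟩

theorem Runs.ceil (x : ℝ) : Runs Good (Prog.ceil x Prog.ret : Prog ℝ E ℕ) ⌈x⌉₊ 1 0 :=
  ⟨rfl, le_rfl, le_rfl, by simp [events]⟩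

theorem Runs.seq {P : Prog ℝ E X} {f : X → Prog ℝ E Y} {x : X} {y : Y} {t t' k k' : ℕ}
    (h : Runs Good P x t k) (h' : Runs Good (f x) y t' k') :
    Runs Good (Prog.seq P f) y (t + t') (k + k') := by
  obtain ⟨rfl, h2, h3, h4⟩ := h
  obtain ⟨rfl, h2', h3', h4'⟩ := h'
  refine ⟨result_seq P f, ?_, ?_, ?_⟩
  · rw [time_seq]
    omega
  · rw [events_seq, List.length_append]
    omega
  · intro e he
    rw [events_seq, List.mem_append] at he
    exact he.elim (h4 e) (h4' e)

theorem Runs.bind {P : Prog ℝ E X} {f : X → Prog ℝ E Y} {x : X} {y : Y} {t t' k k' : ℕ}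
    (h : Runs Good P x t k) (h' : Runs Good (f x) y t' k') :
    Runs Good (P >>= f) y (t + t') (k + k') :=
  h.seq h'

theorem Runs.exec_bind {o : Instr ℝ} {f : ℝ → Prog ℝ E Y} {y : Y} {t k : ℕ}
    (h : Runs Good (f o.eval) y t k) : Runs Good (Prog.exec o >>= f) y (t + 1) k :=
  ((Runs.exec o).bind h).mono (by omega) (by omega)

theorem Runs.test_bind {a b : ℝ} {f : Bool → Prog ℝ E Y} {y : Y} {t k : ℕ}
    (h : Runs Good (f (decide (a ≤ b))) y t k) :
    Runs Good (Prog.test a b >>= f) y (t + 1) k := by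
  have h0 : Runs Good (Prog.test a b : Prog ℝ E Bool) (decide (a ≤ b)) 1 0 :=
    ⟨rfl, le_rfl, le_rfl, by simp [events, Prog.test]⟩
  exact (h0.bind h).mono (by omega) (by omega)

theorem Runs.report_bind {e : E} {f : Unit → Prog ℝ E Y} {y : Y} {t k : ℕ} (he : Good e)
    (h : Runs Good (f ()) y t k) : Runs Good (Prog.report e >>= f) y (t + 1) (k + 1) := by
  have h0 : Runs Good (Prog.report e : Prog ℝ E Unit) () 1 1 :=
    ⟨rfl, le_rfl, le_rfl, by simpa [events, Prog.report] using he⟩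
  exact (h0.bind h).mono (by omega) (by omega)

/-- A loop whose states are known in advance. -/
theorem Runs.loop {k : ℕ} {f : Fin k → X → Prog ℝ E X} {t c : ℕ} (S : ℕ → X)
    (h : ∀ i : Fin k, Runs Good (f i (S i)) (S (i + 1)) t c) :
    Runs Good (Prog.loop k f (S 0)) (S k) (k * (t + 1)) (k * c) := by
  induction k generalizing S with
  | zero => exact (Runs.ret _).mono (by omega) (by omega)
  | succ k ih =>
    have h1 := ih (f := fun i => f i.succ) (fun i => S (i + 1)) fun i => h i.succ
    exact (((h 0).seq h1).tick).mono (by rw [Nat.succ_mul]; omega) (by rw [Nat.succ_mul]; omega)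

/-- A loop that acts by a fold on the states which satisfy an invariant. -/
theorem Runs.loop_foldl {k : ℕ} {f : Fin k → X → Prog ℝ E X} {t c : ℕ} {F : X → Fin k → X}
    (I : X → Prop) (h : ∀ i s, I s → Runs Good (f i s) (F s i) t c ∧ I (F s i)) {s : X}
    (hs : I s) :
    Runs Good (Prog.loop k f s) ((List.finRange k).foldl F s) (k * (t + 1)) (k * c) := by
  induction k generalizing s with
  | zero => exact (Runs.ret _).mono (by omega) (by omega)
  | succ k ih =>
    obtain ⟨h0, h1⟩ := h 0 s hs
    have h2 := ih (f := fun i => f i.succ) (F := fun s i => F s i.succ) (fun i => h i.succ) h1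
    rw [List.finRange_succ, List.foldl_cons, List.foldl_map]
    exact ((h0.seq h2).tick).mono (by rw [Nat.succ_mul]; omega) (by rw [Nat.succ_mul]; omega)

theorem Runs.array {k : ℕ} {f : Fin k → Prog ℝ E X} {t c : ℕ} {v : Fin k → X}
    (h : ∀ i, Runs Good (f i) (v i) t c) :
    Runs Good (Prog.array k f) v (k * (t + 1)) (k * c) := by
  induction k with
  | zero => exact ((Runs.ret _).mono (by omega) (by omega)).congr (Subsingleton.elim _ _)
  | succ k ih =>
    have h1 := ih (f := fun i => f i.succ) (v := fun i => v i.succ) fun i => h i.succ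
    have h2 := ((h 0).seq (f := fun x => Prog.seq (Prog.array k fun i => f i.succ)
      fun v => Prog.ret (Fin.cons (α := fun _ => X) x v))
      (h1.seq (Runs.ret (Good := Good) (Fin.cons (α := fun _ => X) (v 0)
      (fun i => v i.succ))))).tick
    refine (h2.mono ?_ ?_).congr (Fin.cons_self_tail v)
    · rw [Nat.succ_mul]; omega
    · rw [Nat.succ_mul]; omega

/-! ## Linear algebra programs -/

theorem foldl_add_eq (l : List (Fin n)) (g : Fin n → ℝ) (z : ℝ) :
    l.foldl (fun s j => s + g j) z = z + (l.map g).sum := by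
  induction l generalizing z with
  | nil => simp
  | cons i l ih => rw [List.foldl_cons, ih, List.map_cons, List.sum_cons, add_assoc]

theorem runs_dot (u v : Fin n → ℝ) :
    Runs Good (dot u v : Prog ℝ E ℝ) (u ⬝ᵥ v) (3 * n + 1) 0 := by
  refine Runs.exec_bind ?_
  have h : ∀ (j : Fin n) (s : ℝ), True → Runs Good (do
      let t ← Prog.exec (.mul (u j) (v j))
      Prog.exec (.add s t) : Prog ℝ E ℝ) (s + u j * v j) 2 0 ∧ True :=
    fun j s _ => ⟨Runs.exec_bind (Runs.exec _), trivial⟩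
  refine ((Runs.loop_foldl (F := fun s j => s + u j * v j) (fun _ => True) h trivial).mono
    (by omega) (by omega)).congr ?_
  rw [foldl_add_eq, ← Fin.sum_univ_def]
  simp [Instr.eval, dotProduct]

theorem runs_mulVec (N : Matrix (Fin n) (Fin n) ℝ) (a : Fin n → ℝ) :
    Runs Good (mulVec N a : Prog ℝ E (Fin n → ℝ)) (N *ᵥ a) (n * (3 * n + 2)) 0 :=
  (Runs.array fun i => runs_dot (N i) a).mono le_rfl (by omega)

theorem runs_quadForm (hn : 0 < n) (N : Matrix (Fin n) (Fin n) ℝ) (a : Fin n → ℝ) :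
    Runs Good (quadForm N a : Prog ℝ E ℝ) (a ⬝ᵥ (N *ᵥ a)) (9 * n ^ 2) 0 :=
  ((runs_mulVec N a).bind (runs_dot a _)).mono (by nlinarith) (by omega)

theorem runs_shermanMorrison (hn : 0 < n) (N : Matrix (Fin n) (Fin n) ℝ) (a : Fin n → ℝ) (t : ℝ) :
    Runs Good (shermanMorrison N a t : Prog ℝ E (Fin n → Fin n → ℝ))
      (fun i j => N i j - t / (1 + t * (a ⬝ᵥ (N *ᵥ a))) * (N *ᵥ a) i * (N *ᵥ a) j)
      (18 * n ^ 2) 0 := by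
  refine (Runs.bind (t' := 3 * n + 1 + (n * (3 * n + 2) + 4)) (k' := 0) (runs_mulVec N a)
    (Runs.bind (k' := 0) (runs_dot a (N *ᵥ a)) ?_)).mono (by nlinarith) (by omega)
  refine Runs.exec_bind (Runs.exec_bind (Runs.exec_bind (Runs.exec_bind ?_)))
  refine (Runs.array (t := 3 * n + 1) (c := 0) fun i => ?_).mono (by nlinarith) (by omega)
  refine Runs.exec_bind ?_
  refine (Runs.array (t := 2) (c := 0) fun j => ?_).mono (by omega) (by omega)
  refine Runs.exec_bind ((Runs.exec _).congr ?_)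
  simp only [Instr.eval, Nat.cast_one]

/-- The entries of the inverse matrix. -/
def invEntries (M : Matrix (Fin n) (Fin n) ℝ) : Fin n → Fin n → ℝ :=
  fun i j => (M⁻¹ : Matrix (Fin n) (Fin n) ℝ) i j

/-- `shermanMorrison` maps the inverse of a positive definite matrix to the inverse of a positive
definite rank-one update. -/
theorem runs_shermanMorrison_inv (hn : 0 < n) {M M' : Matrix (Fin n) (Fin n) ℝ} (a : Fin n → ℝ)
    (t : ℝ) (hM : M.PosDef) (hM' : M'.PosDef) (h : M' = M + t • vecMulVec a a) :
    Runs Good (shermanMorrison (invEntries M) a t : Prog ℝ E (Fin n → Fin n → ℝ)) (invEntries M')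
      (18 * n ^ 2) 0 := by
  have hdet : IsUnit M.det := hM.det_pos.ne'.isUnit
  -- The denominator is the ratio of the two determinants.
  have hne : 1 + t * (a ⬝ᵥ (M⁻¹ *ᵥ a)) ≠ 0 := by
    intro h0
    have h1 := hM'.det_pos
    rw [h, det_add_smul_vecMulVec _ _ hdet, h0, mul_zero] at h1
    exact lt_irrefl _ h1
  refine (runs_shermanMorrison hn M⁻¹ a t).congr ?_
  funext i j
  rw [invEntries, h, inv_add_smul_vecMulVec a t hdet hM.isHermitian hne]
  simp only [Matrix.sub_apply, Matrix.smul_apply, vecMulVec_apply, smul_eq_mul, mul_assoc]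

/-- Describes the states of a loop that overwrites `g` by `f` entry by entry. -/
theorem ite_lt_succ_eq_update {k : ℕ} (f g : Fin k → ℝ) (i : Fin k) :
    (fun j : Fin k => if (j : ℕ) < i + 1 then f j else g j) =
      Function.update (fun j : Fin k => if (j : ℕ) < i then f j else g j) i (f i) := by
  funext j
  by_cases h : j = i
  · subst h
    simp
  · have h' : (j : ℕ) ≠ i := fun h' => h (Fin.ext h')
    rw [Function.update_of_ne h]
    exact if_congr (by omega) rfl rfl

theorem runs_initialInverse (hn : 0 < n) {A : Matrix (Fin m) (Fin n) ℝ} (hA : A.rank = n) {x : ℝ}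
    (hx : 0 < x) :
    Runs Good (initialInverse A x : Prog ℝ E (Fin n → Fin n → ℝ)) (invEntries (gram A fun _ => x))
      (44 * (m * n ^ 2)) 0 := by
  obtain ⟨hm, hnm⟩ := pos_of_rank hn hA
  set z : ℝ := Instr.eval (.const 0) with hz
  set o : ℝ := Instr.eval (.const 1) with ho
  have hz0 : z = 0 := by simp [hz, Instr.eval]
  have ho1 : o = 1 := by simp [ho, Instr.eval]
  -- `M k` and `D k` are the matrices whose inverses are held after `k` passes of the first and
  -- second loop. Keeping the identity until all rows are added makes each of them positive
  -- definite.
  set D : ℕ → Matrix (Fin n) (Fin n) ℝ :=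
    fun k => gram A (fun _ => x) + diagonal fun j : Fin n => if (j : ℕ) < k then 0 else 1 with hD
  set M : ℕ → Matrix (Fin n) (Fin n) ℝ :=
    fun k => 1 + gram A fun i : Fin m => if (i : ℕ) < k then x else 0 with hM
  have hMpos : ∀ k, (M k).PosDef := fun k => PosDef.one.add_posSemidef
    (gram_posSemidef A fun i => by split_ifs <;> linarith)
  have hDpos : ∀ k, (D k).PosDef := fun k => (gram_posDef hA fun _ => hx).add_posSemidef
    (PosSemidef.diagonal fun i => by simp only [Pi.zero_apply]; split_ifs <;> norm_num)
  have hid : Runs Good (Prog.array n (fun i => Prog.array n (fun j =>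
      Prog.ret (if i = j then o else z))) : Prog ℝ E (Fin n → Fin n → ℝ)) (invEntries (M 0))
      (n * (n + 1)) 0 := by
    refine (Runs.array (t := n) (c := 0) fun i => (Runs.array (t := 0) (c := 0) fun j =>
      (Runs.ret _).congr ?_).mono (by omega) (by omega)).mono le_rfl (by omega)
    have h0 : M 0 = 1 := by
      ext k l
      simp [hM, gram_apply]
    rw [invEntries, h0, inv_one, one_apply, ho1, hz0]
  have hloop1 : Runs Good (Prog.loop m (fun i N => shermanMorrison N (A i) x) (invEntries (M 0)) :
      Prog ℝ E (Fin n → Fin n → ℝ)) (invEntries (M m)) (m * (18 * n ^ 2 + 1)) (m * 0) := by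
    refine Runs.loop (fun k => invEntries (M k)) fun i => ?_
    refine runs_shermanMorrison_inv hn (A i) x (hMpos _) (hMpos _) ?_
    simp only [hM]
    rw [ite_lt_succ_eq_update (fun _ => x) (fun _ => 0) i, gram_update, ← add_assoc]
    simp
  have hMD : M m = D 0 := by
    simp [hM, hD, add_comm]
  have hloop2 : Runs Good (Prog.loop n (fun j N => do
      let e ← Prog.array n (fun i => Prog.ret (if i = j then o else z))
      shermanMorrison N e (Instr.eval (.sub z o))) (invEntries (D 0)) :
      Prog ℝ E (Fin n → Fin n → ℝ)) (invEntries (D n)) (n * (n + 18 * n ^ 2 + 1)) (n * 0) := by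
    refine Runs.loop (fun k => invEntries (D k)) fun j => ?_
    refine (Runs.bind (x := fun i => if i = j then o else z) (t := n) (k := 0)
      ((Runs.array (t := 0) (c := 0) fun i => Runs.ret _).mono (by omega) (by omega))
      (runs_shermanMorrison_inv hn _ _ (hDpos j) (hDpos (j + 1)) ?_)).mono le_rfl le_rfl
    simp only [hD]
    rw [ite_lt_succ_eq_update (fun _ => 0) (fun _ => 1) j, add_assoc]
    congr 1
    ext k l
    simp only [Instr.eval, hz0, ho1, diagonal_apply, Matrix.add_apply, Matrix.smul_apply,
      vecMulVec_apply, smul_eq_mul, Function.update_apply]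
    by_cases hkl : k = l
    · subst hkl
      by_cases hkj : k = j
      · subst hkj
        simp
      · simp [hkj]
    · by_cases hkj : k = j
      · subst hkj
        simp [hkl, Ne.symm hkl]
      · simp [hkl, hkj]
  have hDn : D n = gram A fun _ => x := by
    simp [hD]
  rw [← hDn]
  refine (Runs.exec_bind (Runs.exec_bind (Runs.exec_bind (hid.bind
    ((hloop1.congr (by rw [hMD])).bind hloop2))))).mono ?_ (by omega)
  have h1 : n ≤ n ^ 2 := by nlinarith
  have h2 : n * n ^ 2 ≤ m * n ^ 2 := Nat.mul_le_mul_right _ hnm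
  have h3 : n ^ 2 ≤ m * n ^ 2 := Nat.le_mul_of_pos_left _ hm
  have h4 : m ≤ m * n ^ 2 := Nat.le_mul_of_pos_right _ (by positivity)
  nlinarith

end Prog

/-! ## The implementation -/

theorem leverageScore_eq_sigma (A : Matrix (Fin m) (Fin n) ℝ) {w : Fin m → ℝ} (hw : ∀ i, 0 < w i)
    (i : Fin m) :
    leverageScore (diagonal (fun j => Real.sqrt (w j)) * A) i = sigma A w i := by
  have h1 : (diagonal (fun j => Real.sqrt (w j)) * A)ᵀ * (diagonal (fun j => Real.sqrt (w j)) * A) =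
      gram A w := by
    rw [transpose_mul, diagonal_transpose, Matrix.mul_assoc, ← Matrix.mul_assoc (diagonal _),
      diagonal_mul_diagonal, gram, Matrix.mul_assoc]
    simp only [Real.mul_self_sqrt (hw _).le]
  rw [leverageScore, h1, transpose_mul, diagonal_transpose, Matrix.mul_assoc, Matrix.mul_assoc,
    ← Matrix.mul_assoc _ Aᵀ, diagonal_mul, ← Matrix.mul_assoc, mul_diagonal, sigma, rowForm]
  have h2 : (A * ((gram A w)⁻¹ * Aᵀ)) i i = A i ⬝ᵥ ((gram A w)⁻¹ *ᵥ A i) := by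
    rw [Matrix.mul_apply]
    rfl
  rw [h2]
  nth_rewrite 3 [← Real.mul_self_sqrt (hw i).le]
  ring

/-- The record of an iteration is correct. -/
def IsLeverageIteration (A : Matrix (Fin m) (Fin n) ℝ) (e : Iteration m ℝ) : Prop :=
  (∀ j, 0 < e.weights j) ∧
    e.score = leverageScore (diagonal (fun j => Real.sqrt (e.weights j)) * A) e.row

namespace Prog

/-- The memory that holds `w` and the exact inverse of `Aᵀ W A`. -/
def exactMemory (A : Matrix (Fin m) (Fin n) ℝ) (w : Fin m → ℝ) : Memory m n ℝ :=
  ⟨w, invEntries (gram A w)⟩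

section

variable {A : Matrix (Fin m) (Fin n) ℝ}

theorem runs_score (hn : 0 < n) {w : Fin m → ℝ} (hw : ∀ i, 0 < w i) (i : Fin m) :
    Runs (IsLeverageIteration A) (score A (exactMemory A w) i) (rowForm A w i, sigma A w i)
      (9 * n ^ 2 + 2) 1 := by
  have h : Runs (IsLeverageIteration A) (quadForm (exactMemory A w).inv (A i)) (rowForm A w i)
      (9 * n ^ 2) 0 := runs_quadForm hn (gram A w)⁻¹ (A i)
  refine (Runs.bind (t' := 2) (k' := 1) h ?_).mono le_rfl le_rfl
  refine Runs.exec_bind (Runs.report_bind (t := 0) (k := 0) ⟨hw, ?_⟩ (Runs.pure _))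
  exact (leverageScore_eq_sigma A hw i).symm

theorem runs_ratio {E : Type} {Good : E → Prop} (α : ℝ) (w : Fin m → ℝ) (i : Fin m) :
    Runs Good (ratio α (exactMemory A w) i (sigma A w i)) (rho A α w i) 4 0 := by
  refine Runs.exec_bind (Runs.exec_bind (Runs.exec_bind ((Runs.exec _).congr ?_)))
  simp [Instr.eval, rho, exactMemory]

theorem runs_setWeight (hn : 0 < n) (hA : A.rank = n) {E : Type} {Good : E → Prop} {w
    : Fin m → ℝ} (hw : ∀ i, 0 < w i)
    (i : Fin m) {x : ℝ} (hx : 0 < x) :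
    Runs Good (setWeight A (exactMemory A w) i x) (exactMemory A (Function.update w i x))
      (18 * n ^ 2 + 1) 0 := by
  have hw' : ∀ j, 0 < Function.update w i x j := by
    intro j
    by_cases h : j = i
    · subst h; simpa using hx
    · simpa [Function.update_of_ne h] using hw j
  refine Runs.exec_bind ((Runs.bind (t' := 0) (k' := 0)
    (f := fun N => Pure.pure (⟨Function.update w i x, N⟩ : Memory m n ℝ))
    (runs_shermanMorrison_inv hn (A i) _
    (gram_posDef hA hw) (gram_posDef hA hw') ?_) (Runs.pure _)).mono le_rfl le_rfl)
  exact gram_update A w i x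

theorem coordStep_pos (hA : A.rank = n) {α : ℝ} (hα : 0 < α) {w : Fin m → ℝ} (hw : ∀ i, 0 < w i)
    (i j : Fin m) :
    0 < coordStep A α w i j :=
  (hw j).trans_le ((coordStep_spec hA hα hw i).1 j)

theorem runs_roundSequential (hn : 0 < n) (hA : A.rank = n) {α : ℝ} (hα : 0 < α) {w : Fin m → ℝ}
    (hw : ∀ i, 0 < w i) :
    Runs (IsLeverageIteration A) (roundSequential A α (exactMemory A w))
      (exactMemory A (Lewis.roundSequential A α w)) (40 * (m * n ^ 2)) m := by
  have hn2 : 1 ≤ n ^ 2 := Nat.one_le_pow _ _ hn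
  -- The fold on memories mirrors the fold on weight vectors, so only exact memories with positive
  -- weights need to be considered.
  have hfold : ∀ l : List (Fin m), l.foldl
      (fun s i => exactMemory A (coordStep A α s.w i)) (exactMemory A w) =
        exactMemory A (l.foldl (coordStep A α) w) := fun l =>
    (List.foldl_hom (exactMemory A) fun _ _ => rfl)
  rw [Lewis.roundSequential, ← hfold]
  refine (Runs.loop_foldl (t := 39 * n ^ 2) (c := 1)
    (fun s => ∃ u : Fin m → ℝ, (∀ i, 0 < u i) ∧ s = exactMemory A u) ?_
    ⟨w, hw, rfl⟩).mono (by nlinarith) (by omega)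
  rintro i _ ⟨u, hu, rfl⟩
  refine ⟨?_, coordStep A α u i, coordStep_pos hA hα hu i, rfl⟩
  refine (Runs.bind (t' := 18 * n ^ 2 + 10) (k' := 0) (runs_score hn hu i) ?_).mono
    (by omega) le_rfl
  refine (Runs.bind (t' := 18 * n ^ 2 + 6) (k' := 0) (runs_ratio α u i) ?_).mono
    (by omega) le_rfl
  refine Runs.exec_bind (Runs.test_bind ?_)
  have hpos := coordStep_pos hA hα hu i i
  have h1 : Instr.eval (.const 1) = 1 := by simp [Instr.eval]
  by_cases hρ : 1 ≤ rho A α u i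
  · rw [coordStep, if_pos hρ, Function.update_self] at hpos
    rw [h1, decide_eq_true hρ]
    refine (Runs.exec_bind (Runs.exec_bind (Runs.exec_bind
      (((runs_setWeight hn hA hu i (x := _) ?_)).congr ?_))))
    · exact hpos
    · change _ = exactMemory A (coordStep A α u i)
      rw [coordStep, if_pos hρ]
      rfl
  · rw [h1, decide_eq_false hρ]
    refine ((Runs.pure _).congr ?_).mono (by omega) (by omega)
    change _ = exactMemory A (coordStep A α u i)
    rw [coordStep, if_neg hρ]

theorem runs_descent (hn : 0 < n) (hA : A.rank = n) {α η : ℝ} {w : Fin m → ℝ} (hw : ∀ i, 0 < w i)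
    (hw' : ∀ i, 0 < Lewis.descent A α (fun _ => η) w i) :
    Runs (IsLeverageIteration A) (descent A α η (exactMemory A w))
      (exactMemory A (Lewis.descent A α (fun _ => η) w)) (43 * (m * n ^ 2)) m := by
  have hn2 : 1 ≤ n ^ 2 := Nat.one_le_pow _ _ hn
  have hmn : m ≤ m * n ^ 2 := Nat.le_mul_of_pos_right _ hn2
  refine (Runs.bind (x := Lewis.descent A α (fun _ => η) w) (t := m * (9 * n ^ 2 + 13 + 1))
    (k := m * 1) (t' := m * (18 * n ^ 2 + 1 + 1)) (k' := m * 0) (Runs.array fun i => ?_) ?_).mono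
    (by nlinarith) (by omega)
  · refine (Runs.bind (t' := 11) (k' := 0) (runs_score hn hw i) ?_).mono (by omega) le_rfl
    refine (Runs.bind (t' := 7) (k' := 0) (runs_ratio α w i) ?_).mono (by omega) le_rfl
    refine Runs.exec_bind (Runs.exec_bind (Runs.exec_bind (Runs.exec_bind (Runs.exec_bind
      (Runs.exec_bind ((Runs.exec _).congr ?_))))))
    simp [Instr.eval, Lewis.descent, exactMemory]
  · set x := Lewis.descent A α (fun _ => η) w with hx
    -- All new entries were computed from the old vector. While they are installed, the weights mix
    -- old and new entries, all positive, so each update is legitimate.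
    have h := Runs.loop (Good := IsLeverageIteration A) (k := m)
      (f := fun i s => setWeight A s i (x i)) (t := 18 * n ^ 2 + 1) (c := 0)
      (fun k => exactMemory A fun j : Fin m => if (j : ℕ) < k then x j else w j) (fun i => by
        simp only [ite_lt_succ_eq_update]
        exact runs_setWeight hn hA (fun j => by split_ifs <;> [exact hw' j; exact hw j]) i (hw' i))
    simpa using h

theorem runs_totalRounds {E : Type} {Good : E → Prop} (c m n : ℕ) (α ε : ℝ) :
    Runs Good (totalRounds c m n α ε : Prog ℝ E ℕ) (Lewis.totalRounds c m n α ε) 25 0 := by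
  iterate 24 refine Runs.exec_bind ?_
  refine ((Runs.ceil _).congr ?_).mono (by omega) le_rfl
  rw [Lewis.totalRounds, tildeEps]
  simp only [Instr.eval, Real.rpow_natCast]
  norm_num

theorem runs_lewis (hn : 0 < n) (hA : A.rank = n) {p ε : ℝ} (hp : 4 ≤ p) (c : ℕ) :
    Runs (IsLeverageIteration A) (lewis c A p ε) (lewisOutput c A p ε)
      (84 * (Lewis.totalRounds c m n (alpha p) ε * (m * n ^ 2)) + 140 * (m * n ^ 2))
      (2 * (m * Lewis.totalRounds c m n (alpha p) ε) + 2 * m) := by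
  obtain ⟨hm, hnm⟩ := pos_of_rank hn hA
  have hn2 : 1 ≤ n ^ 2 := Nat.one_le_pow _ _ hn
  have hmn : 1 ≤ m * n ^ 2 := Nat.mul_pos hm hn2
  have hmn' : m ≤ m * n ^ 2 := Nat.le_mul_of_pos_right _ hn2
  have hα := alpha_pos hp
  have hα1 := alpha_le_one hp
  set T := Lewis.totalRounds c m n (alpha p) ε with hT
  have hpos := iterates_pos hn hA hα hα1
  have e1 : Instr.eval (.const 1) = 1 := by simp [Instr.eval]
  have eα : Instr.eval (.div (Instr.eval (.const 2))
      (Instr.eval (.sub p (Instr.eval (.const 2))))) = alpha p := by simp [Instr.eval, alpha]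
  have eη : Instr.eval (.div (Instr.eval (.const 1)) (Instr.eval (.mul (Instr.eval (.const 3))
      (Instr.eval (.max (alpha p) (Instr.eval (.const 1))))))) = 1 / (3 * max (alpha p) 1) := by
    simp [Instr.eval]
  have ex : Instr.eval (.div (Instr.eval (.const n)) (Instr.eval (.const m))) = (n : ℝ) / m := by
    simp [Instr.eval]
  have hx : (0 : ℝ) < n / m := by
    have : (0 : ℝ) < m := by exact_mod_cast hm
    have : (0 : ℝ) < n := by exact_mod_cast hn
    positivity
  set B := m * n ^ 2 with hB
  -- The `8` pays for the opening scalar instructions; the later `36` adds `25` for the round count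
  -- and `3` for `n / m`. The slack in `140 * B` absorbs these since `B ≥ 1`.
  have hbound : 84 * (T * B) + 140 * B = (84 * (T * B) + 140 * B - 8) + 8 := by omega
  rw [hbound]
  iterate 4 refine Runs.exec_bind ?_
  refine Runs.exec_bind ?_
  rw [eα]
  iterate 3 refine Runs.exec_bind ?_
  rw [eη]
  refine (Runs.bind (t' := (84 * (T * B) + 140 * B - 36) + 3) (k' := 2 * (m * T) + 2 * m)
    (runs_totalRounds c m n (alpha p) ε) ?_).mono (by omega) (by omega)
  iterate 3 refine Runs.exec_bind ?_
  rw [ex]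
  refine (Runs.bind (x := fun _ => (n : ℝ) / m) (t := m * (0 + 1)) (k := m * 0)
    (t' := 44 * B + (84 * (T * B) + (40 * B + (1 + 13 * B)))) (k' := 2 * (m * T) + 2 * m)
    (Runs.array fun _ => Runs.pure _) ?_).mono (by omega) (by omega)
  refine (Runs.bind (t' := 84 * (T * B) + (40 * B + (1 + 13 * B))) (k' := 2 * (m * T) + 2 * m)
    (runs_initialInverse hn hA hx) ?_).mono (by omega) (by omega)
  have hmain : Runs (IsLeverageIteration A) (Prog.loop T (fun _ s => do
      let t ← roundSequential A (alpha p) s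
      descent A (alpha p) (1 / (3 * max (alpha p) 1)) t) (exactMemory A (iterates A (alpha p) 0)))
      (exactMemory A (iterates A (alpha p) T)) (T * (83 * B + 1)) (T * (2 * m)) := by
    refine Runs.loop (fun k => exactMemory A (iterates A (alpha p) k)) fun k => ?_
    obtain ⟨h1, -, h3⟩ := roundSequential_spec hA hα (hpos k)
    exact ((runs_roundSequential hn hA hα (hpos k)).bind
      (runs_descent hn hA h1 (descent_spec hA hα hα1 h1 h3).1)).mono (by omega) (by omega)
  refine (Runs.bind (t' := 40 * B + (1 + 13 * B)) (k' := 2 * m) hmain ?_).mono ?_ ?_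
  · obtain ⟨h1, -, -⟩ := roundSequential_spec hA hα (hpos T)
    refine (Runs.bind (t' := 1 + 13 * B) (k' := m)
      (runs_roundSequential hn hA hα (hpos T)) ?_).mono (by omega) (by omega)
    refine (Runs.exec_bind (t := 13 * B) ?_).mono (by omega) le_rfl
    refine (Runs.array (t := 9 * n ^ 2 + 3) (c := 1) fun i => ?_).mono (by nlinarith) (by omega)
    refine (Runs.bind (t' := 1) (k' := 0) (runs_score hn h1 i) ?_).mono (by omega) le_rfl
    refine (Runs.exec _).congr ?_
    simp [Instr.eval, lewisOutput, ← hT]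
  · have : T ≤ T * B := Nat.le_mul_of_pos_right _ hmn
    nlinarith
  · have : T * (2 * m) = 2 * (m * T) := by ring
    omega

end

end Prog

/-! ## Complexity -/

theorem log_div_tildeEps_le {p ε : ℝ} (hn : 0 < n) (hnm : n ≤ m) (hp : 4 ≤ p) (hε : 0 < ε)
    (hε1 : ε ≤ 1) :
    Real.log (m / tildeEps m n (alpha p) ε) ≤ 37 * Real.log (m * p / ε) := by
  have hm1 : (1 : ℝ) ≤ m := by exact_mod_cast hn.trans_le hnm
  have hnm' : (n : ℝ) ≤ m := by exact_mod_cast hnm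
  have hα := alpha_pos hp
  have hα1 := alpha_le_one hp
  have hinv : 1 / alpha p = (p - 2) / 2 := by rw [alpha, one_div_div]
  have hsqrt : Real.sqrt n ≤ m := by
    rw [Real.sqrt_le_left (by linarith)]
    nlinarith
  -- The single quantity `x ≥ 4` dominates `m`, `p`, `1 / ε` and `1 / α`. As `50 ≤ x ^ 3`, the base
  -- is at most `x ^ 6`, and the total exponent is `1 + 24 + 8 + 4 = 37`.
  set x : ℝ := m * p / ε with hx
  have hmx : m ≤ x := by
    rw [hx, le_div_iff₀ hε]
    nlinarith
  have hpx : p ≤ x := by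
    rw [hx, le_div_iff₀ hε]
    nlinarith
  have hεx : 1 / ε ≤ x := by
    rw [hx]
    exact div_le_div_of_nonneg_right (by nlinarith) hε.le
  have hx4 : 4 ≤ x := hp.trans hpx
  have hx0 : 0 ≤ x := by linarith
  have hbase : 25 * (m : ℝ) * (Real.sqrt n + alpha p) * (alpha p + 1 / alpha p) ≤ 50 * x ^ 3 := by
    have h1 : Real.sqrt n + alpha p ≤ 2 * x := by linarith
    have h2 : alpha p + 1 / alpha p ≤ x := by rw [hinv]; linarith
    calc 25 * (m : ℝ) * (Real.sqrt n + alpha p) * (alpha p + 1 / alpha p)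
        ≤ 25 * x * (2 * x) * x := by gcongr
      _ = 50 * x ^ 3 := by ring
  have hαx : 1 / alpha p ≤ x := by rw [hinv]; linarith
  have hE : (m : ℝ) / tildeEps m n (alpha p) ε = m * (25 * (m : ℝ) * (Real.sqrt n + alpha p) *
      (alpha p + 1 / alpha p)) ^ 4 * (1 / alpha p) ^ 8 * (1 / ε) ^ 4 := by
    have h0 : (25 * (m : ℝ) * (Real.sqrt n + alpha p) * (alpha p + 1 / alpha p)) ≠ 0 := by
      positivity
    rw [tildeEps]
    generalize 25 * (m : ℝ) * (Real.sqrt n + alpha p) * (alpha p + 1 / alpha p) = b at h0 ⊢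
    field_simp
  have hE2 : (m : ℝ) / tildeEps m n (alpha p) ε ≤ x ^ 37 := by
    rw [hE]
    have h50 : (50 : ℝ) ≤ x ^ 3 := le_trans (by norm_num) (pow_le_pow_left₀ (by norm_num) hx4 3)
    calc (m : ℝ) * (25 * (m : ℝ) * (Real.sqrt n + alpha p) * (alpha p + 1 / alpha p)) ^ 4 *
          (1 / alpha p) ^ 8 * (1 / ε) ^ 4
        ≤ x * (x ^ 3 * x ^ 3) ^ 4 * x ^ 8 * x ^ 4 := by
          have h3 : 50 * x ^ 3 ≤ x ^ 3 * x ^ 3 :=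
            mul_le_mul_of_nonneg_right h50 (by positivity)
          have h4 := hbase.trans h3
          gcongr
      _ = x ^ 37 := by ring
  have h := Real.log_le_log (div_pos (by linarith) (tildeEps_pos (hn.trans_le hnm) hα hε)) hE2
  rw [Real.log_pow] at h
  exact_mod_cast h

theorem one_le_log {p ε : ℝ} (hm : 0 < m) (hp : 4 ≤ p) (hε : 0 < ε) (hε1 : ε ≤ 1) :
    1 ≤ Real.log (m * p / ε) := by
  have hm1 : (1 : ℝ) ≤ m := by exact_mod_cast hm
  have h4 : 4 ≤ m * p / ε := by
    rw [le_div_iff₀ hε]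
    nlinarith
  rw [Real.le_log_iff_exp_le (by linarith)]
  linarith [Real.exp_one_lt_d9]

theorem totalRounds_le {p ε : ℝ} (hn : 0 < n) (hnm : n ≤ m) (hp : 4 ≤ p) (hε : 0 < ε)
    (hε1 : ε ≤ 1) :
    (totalRounds 12 m n (alpha p) ε : ℝ) ≤ 222 * (p * Real.log (m * p / ε)) + 1 := by
  have hm := hn.trans_le hnm
  have hα := alpha_pos hp
  have hα1 := alpha_le_one hp
  have hL := one_le_log hm hp hε hε1
  have hlog := Real.log_nonneg (one_le_div_tildeEps (m := m) (n := n) hm hn hα hα1 hε hε1)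
  have hle := log_div_tildeEps_le hn hnm hp hε hε1
  have hmax : max (1 / alpha p) (alpha p) ≤ p / 2 := by
    have hinv : 1 / alpha p = (p - 2) / 2 := by rw [alpha, one_div_div]
    rw [hinv]
    exact max_le (by linarith) (by linarith)
  have hmax0 : 0 ≤ max (1 / alpha p) (alpha p) := hα.le.trans (le_max_right _ _)
  have h0 : 0 ≤ (12 : ℕ) * max (1 / alpha p) (alpha p) *
      Real.log (m / tildeEps m n (alpha p) ε) := by positivity
  have h1 := (Nat.ceil_lt_add_one h0).le
  rw [totalRounds]
  refine h1.trans ?_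
  -- With the factor `12` this yields `12 * 37 / 2 = 222`.
  have h2 : max (1 / alpha p) (alpha p) * Real.log (m / tildeEps m n (alpha p) ε) ≤
      p / 2 * (37 * Real.log (m * p / ε)) :=
    mul_le_mul hmax hle hlog (by linarith)
  push_cast
  linarith

end Lewis

end

theorem theorem2 :
    ∃ (c : ℕ) (C : ℝ), ∀ (m n : ℕ) (A : Matrix (Fin m) (Fin n) ℝ) (p ε : ℝ),
      0 < n → A.rank = n → 4 ≤ p → 0 < ε → ε ≤ 1 →
      -- the implementation returns the output of the algorithm
      (Lewis.Prog.lewis c A p ε).result = Lewis.lewisOutput c A p ε ∧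
      -- the output is an `ε`-approximation of the Lewis weights, both in the normalization
      -- of the convex program and in that of the fixed point equation
      (∃ v : Fin m → ℝ, Lewis.IsLewisWeights A p v ∧
        (∀ u : Fin m → ℝ, Lewis.IsLewisWeights A p u → u = v) ∧
        (∀ i, Lewis.Approx ε (Lewis.lewisOutput c A p ε i) (v i ^ (1 - 2 / p))) ∧
        (∀ i, Lewis.Approx ε (Lewis.lewisOutput c A p ε i ^ (p / (p - 2))) (v i)) ∧
        ((∀ i, A i ≠ 0) →
          (∀ i, 0 < Lewis.lewisOutput c A p ε i) ∧
          (∀ i, 0 < v i) ∧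
          ∀ w : Fin m → ℝ, (∀ i, 0 < w i) → w ≠ (fun i => v i ^ (1 - 2 / p)) →
            Lewis.objective A (Lewis.alpha p) (fun i => v i ^ (1 - 2 / p)) <
              Lewis.objective A (Lewis.alpha p) w)) ∧
      -- the number of iterations, and what each of them computes
      ((Lewis.Prog.lewis c A p ε).events.length : ℝ) ≤ C * (p * m * Real.log (m * p / ε)) ∧
      (∀ e ∈ (Lewis.Prog.lewis c A p ε).events, (∀ j, 0 < e.weights j) ∧
        e.score =
          Lewis.leverageScore (Matrix.diagonal (fun j => Real.sqrt (e.weights j)) * A) e.row) ∧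
      -- the total running time
      ((Lewis.Prog.lewis c A p ε).time : ℝ) ≤
        C * (p * m * (n : ℝ) ^ 2 * Real.log (m * p / ε)) := by
  -- The time needs `84 * 222 = 18648`, plus `56` since the remaining `84 + 140 = 224` is at most
  -- `56 * (p * L)` by `p * L ≥ 4`.
  refine ⟨12, 19000, fun m n A p ε hn hA hp hε hε1 => ?_⟩
  have hnm := (Lewis.pos_of_rank hn hA).2
  have hruns := Lewis.Prog.runs_lewis hn hA (ε := ε) hp 12
  have hT := Lewis.totalRounds_le hn hnm hp hε hε1
  have hL := Lewis.one_le_log (hn.trans_le hnm) hp hε hε1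
  set T := Lewis.totalRounds 12 m n (Lewis.alpha p) ε
  set L := Real.log (m * p / ε)
  have hpL : 4 ≤ p * L := by nlinarith
  refine ⟨hruns.result_eq, Lewis.lewisOutput_spec hn hA hp hε hε1, ?_, hruns.good, ?_⟩
  · have h1 : ((Lewis.Prog.lewis 12 A p ε).events.length : ℝ) ≤ 2 * (m * T) + 2 * m := by
      exact_mod_cast hruns.length_le
    have h2 : (m : ℝ) * (2 * T + 2) ≤ m * (19000 * (p * L)) :=
      mul_le_mul_of_nonneg_left (by linarith) (Nat.cast_nonneg m)
    linarith
  · have h1 : ((Lewis.Prog.lewis 12 A p ε).time : ℝ) ≤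
        84 * (T * (m * (n : ℝ) ^ 2)) + 140 * (m * (n : ℝ) ^ 2) := by
      exact_mod_cast hruns.time_le
    have h2 : (m * (n : ℝ) ^ 2) * (84 * T + 140) ≤ (m * (n : ℝ) ^ 2) * (19000 * (p * L)) :=
      mul_le_mul_of_nonneg_left (by linarith) (by positivity)
    linarith
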